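/- **Setting.** Let $\kappa,\sigma,l,L,h>0$: $\kappa=2\pi/\lambda$ is the wavenumber, $\sigma$ the strength of the fluctuations, $l$ the correlation length, $L$ the reference distance from the array to the imaging region (the statement holds for every $L>0$), and $h$ the transducer spacing. For $a>0$ the array of aperture $a$ consists of the transducers $x_1,\dots,x_N$ ($N=N(a)$) that are the points of the planar lattice $h\mathbb Z^2\times\{0\}\subset\mathbb R^3$ in the closed disc of diameter $a$ centred at the origin. Let $\mu$ be a jointly measurable, centred, square-integrable real random field on $\mathbb R^3$ with $\mathbb E(\mu(x)\mu(x'))=R(|x-x'|)$, where $R(0)=1$ and $R$ is continuous and exponentially decaying on $[0,\infty)$. Put $\widehat R(0)=2\int_0^\infty R(t)\,dt$ and $$\vartheta(x,y)=|x-y|\int_0^1\mu\Big(\frac xl+\frac sl(y-x)\Big)ds,\qquad \widehat G_0(x,y)=\frac{e^{i\kappa|x-y|}}{4\pi|x-y|},\qquad \widehat G(x,y)=\widehat G_0(x,y)\,e^{i\sigma\kappa\vartheta(x,y)},$$ and assume that the family $(\vartheta(x,y))_{x,y\in\mathbb R^3}$ is jointly Gaussian (random phase model). Let $g_0(y)=(\widehat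 G_0(x_j,y))_{j=1}^N$, $g(y)=(\widehat G(x_j,y))_{j=1}^N$, with the Euclidean norm of $\mathbb C^N$, and let $*$ denote the conjugate transpose. **Proposition.** Let $y_1\neq y_2$ be two points of the open half-space $\{z>0\}$ (in particular, any two points there with $\lambda\ll|y_1-y_2|\ll L$). Then $g(y_1)$ and $g(y_2)$ are asymptotically orthogonal, and so are $g_0(y_1)$ and $g(y_2)$: $$\frac{g^*(y_1)g(y_2)}{\|g(y_1)\|\,\|g(y_2)\|}\to0\quad\text{and}\quad\frac{g_0^*(y_1)g(y_2)}{\|g_0(y_1)\|\,\|g(y_2)\|}\to0\quad\text{in probability as }a\to\infty.$$ Moreover, the mixed inner product is statistically stable: $$V(a):=\frac{\mathbb E\big|g_0^*(y_1)g(y_2)-\mathbb E(g_0^*(y_1)g(y_2))\big|^2}{\|g_0(y_1)\|^2\,\mathbb E\|g(y_2)\|^2}\longrightarrow0,\qquad a\to\infty,$$ at a rate that is at least logarithmic in $a$: for all sufficiently large $a$, $$V(a)\le\Big(1-e^{-\kappa^2\sigma^2Ll\widehat R(0)}\Big)\,\frac{\log\big(1+\frac{l^2}{4L^2}\big)}{\log\big(1+\frac{a^2}{4L^2}\big)}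 .$$ -/

import Mathlib

open MeasureTheory ProbabilityTheory Filter Topology

noncomputable section

namespace RandomPhase

/-- Physical space, with the Euclidean norm. The array lies in the plane where the last coordinate
vanishes. -/
abbrev Space : Type := EuclideanSpace ℝ (Fin 3)

/-- Position of the transducer with label `p` on the planar square lattice of spacing `h`. -/
def transducer (h : ℝ) (p : ℤ × ℤ) : Space := !₂[h * (p.1 : ℝ), h * (p.2 : ℝ), 0]

/-- Labels of the transducers of the array with aperture `a`: the lattice points of spacing `h` in
the closed disc of diameter `a` centred at the origin (see `mem_arrayLabels_iff`). -/
def arrayLabels (h a : ℝ) : Finset (ℤ × ℤ) :=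
  (Finset.Icc (-⌊a / (2 * h)⌋) ⌊a / (2 * h)⌋ ×ˢ Finset.Icc (-⌊a / (2 * h)⌋) ⌊a / (2 * h)⌋).filter
    (fun p => ‖transducer h p‖ ≤ a / 2)

lemma norm_transducer_sq (h : ℝ) (p : ℤ × ℤ) :
    ‖transducer h p‖ ^ 2 = h ^ 2 * ((p.1 : ℝ) ^ 2 + (p.2 : ℝ) ^ 2) := by
  rw [EuclideanSpace.norm_sq_eq]
  simp [transducer, Fin.sum_univ_three]
  ring

lemma mem_arrayLabels_iff {h : ℝ} (hh : 0 < h) (a : ℝ) (p : ℤ × ℤ) :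
    p ∈ arrayLabels h a ↔ ‖transducer h p‖ ≤ a / 2 := by
  unfold arrayLabels
  rw [Finset.mem_filter]
  refine ⟨fun H => H.2, fun H => ⟨?_, H⟩⟩
  have hsq := norm_transducer_sq h p
  have h0 := norm_nonneg (transducer h p)
  have key : ∀ q : ℤ, h ^ 2 * (q : ℝ) ^ 2 ≤ ‖transducer h p‖ ^ 2 →
      q ∈ Finset.Icc (-⌊a / (2 * h)⌋) ⌊a / (2 * h)⌋ := by
    intro q hq
    have h1 : |h * (q : ℝ)| ≤ a / 2 := by
      refine le_trans (abs_le_of_sq_le_sq ?_ h0) H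
      rw [mul_pow]
      exact hq
    have h2 : |(q : ℝ)| ≤ a / (2 * h) := by
      rw [abs_mul, abs_of_pos hh] at h1
      rw [le_div_iff₀ (by positivity)]
      nlinarith
    have h3 := abs_le.mp h2
    rw [Finset.mem_Icc]
    constructor
    · have : -q ≤ ⌊a / (2 * h)⌋ := by
        rw [Int.le_floor]
        push_cast
        linarith [h3.1]
      omega
    · rw [Int.le_floor]
      exact h3.2
  rw [Finset.mem_product]
  refine ⟨key p.1 ?_, key p.2 ?_⟩ <;> rw [hsq] <;> nlinarith [sq_nonneg (h * (p.1 : ℝ)),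
    sq_nonneg (h * (p.2 : ℝ))]

/-- Homogeneous Green's function `exp (i κ |x - y|) / (4 π |x - y|)`. -/
def G0 (κ : ℝ) (x y : Space) : ℂ :=
  Complex.exp (Complex.I * ((κ * ‖x - y‖ : ℝ) : ℂ)) / ((4 * Real.pi * ‖x - y‖ : ℝ) : ℂ)

variable {Ω : Type*}

/-- The integral of the rescaled fluctuation `μ (· / l)` along the segment from `x` to `y`:
`|x - y| ∫₀¹ μ (x / l + (s / l) (y - x)) ds`. -/
def pathIntegral (μ : Space → Ω → ℝ) (l : ℝ) (x y : Space) (ω : Ω) : ℝ :=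
  ‖x - y‖ * ∫ s in (0 : ℝ)..1, μ ((1 / l) • x + (s / l) • (y - x)) ω

/-- Green's function of the random phase model. -/
def G (μ : Space → Ω → ℝ) (κ σ l : ℝ) (x y : Space) (ω : Ω) : ℂ :=
  G0 κ x y * Complex.exp (Complex.I * ((σ * κ * pathIntegral μ l x y ω : ℝ) : ℂ))

/-- Green's function vector of the homogeneous medium, for the array of aperture `a`. -/
def g0 (κ h a : ℝ) (y : Space) : EuclideanSpace ℂ (arrayLabels h a) :=
  WithLp.toLp 2 fun p => G0 κ (transducer h p) y

/-- Green's function vector of the random medium, for the array of aperture `a`. -/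
def g (μ : Space → Ω → ℝ) (κ σ l h a : ℝ) (y : Space) (ω : Ω) :
    EuclideanSpace ℂ (arrayLabels h a) :=
  WithLp.toLp 2 fun p => G μ κ σ l (transducer h p) y ω

/-- The random medium: `μ` is a jointly measurable, centred, second-order stationary and isotropic
random field with normalized autocorrelation function `R`, which is continuous and decays
exponentially, and the path integrals that make up the random phases are jointly Gaussian. -/
structure IsRandomMedium [MeasurableSpace Ω] (P : Measure Ω) (μ : Space → Ω → ℝ) (R : ℝ → ℝ)
    (l : ℝ) : Prop where
  measurable : Measurable (Function.uncurry μ)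
  memLp : ∀ x, MemLp (μ x) 2 P
  mean_zero : ∀ x, ∫ ω, μ x ω ∂P = 0
  autocorrelation : ∀ x x', ∫ ω, μ x ω * μ x' ω ∂P = R ‖x - x'‖
  normalized : R 0 = 1
  continuousOn : ContinuousOn R (Set.Ici 0)
  decay : ∃ C c : ℝ, 0 < c ∧ ∀ t, 0 ≤ t → |R t| ≤ C * Real.exp (-c * t)
  gaussian : IsGaussianProcess (fun (p : Space × Space) ω => pathIntegral μ l p.1 p.2 ω) P

/-- The number `R̂(0)`: the integral over the real line of the even extension of `R`. -/
def Rhat0 (R : ℝ → ℝ) : ℝ := 2 * ∫ t in Set.Ioi (0 : ℝ), R t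

/-- Variance `𝔼 |X - 𝔼 X|²` of a complex random variable. -/
def complexVariance [MeasurableSpace Ω] (P : Measure Ω) (X : Ω → ℂ) : ℝ :=
  ∫ ω, ‖X ω - ∫ ω', X ω' ∂P‖ ^ 2 ∂P

/-- Normalized variance of the mixed inner product:
`𝔼 |g₀(y₁)⃰ g(y₂) - 𝔼 (g₀(y₁)⃰ g(y₂))|² / (‖g₀(y₁)‖² 𝔼 ‖g(y₂)‖²)`. -/
def mixedRatio [MeasurableSpace Ω] (P : Measure Ω) (μ : Space → Ω → ℝ) (κ σ l h : ℝ)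
    (y₁ y₂ : Space) (a : ℝ) : ℝ :=
  complexVariance P (fun ω => inner ℂ (g0 κ h a y₁) (g μ κ σ l h a y₂ ω)) /
    (‖g0 κ h a y₁‖ ^ 2 * ∫ ω, ‖g μ κ σ l h a y₂ ω‖ ^ 2 ∂P)

end RandomPhase

end

/-! The random phases have modulus one, so `‖g‖ = ‖g0‖` is deterministic. Since `|G0|²` is
comparable to the inverse square of the distance, `‖g0‖²` is at least a multiple of `log a`. Each
normalized inner product thus reduces to the second moment of a sum of amplitudes of size `weight p`
times Gaussian phase factors. Expanding the square gives expectations `𝔼 exp (i (X - Y))` of modulus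
`exp (-Var (X - Y) / 2)`. By the reverse triangle inequality in `L²` this is at most `exp (-(s - t)²
/ 2)`, where `s` and `t` are the standard deviations of `X` and `Y`. So only the variance at each
transducer matters, and the second moment is bounded by `pairSum`.

For the mixed product the variance of a phase is a positive multiple of the distance plus `O(1)`.
Two transducers then interact only if their distances from the origin are nearly equal, and
`pairSum_le_of_linear` gives `o(log a)`. After division by a multiple of `(log a)²`, the ratio
`V(a)` is `o(1 / log a)`, so the stated logarithmic bound holds eventually because its constant is
positive.

For `g*(y₁) g(y₂)` the phase is the difference of the paths from one transducer to `y₁` and `y₂`.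
Its variance is at most linear in the distance, and at least linear except where the two points are
seen at a very small angle. Those transducers lie in a narrow sector or a bounded set, of small
logarithmic density, and `pairSum_le_of_sparse` gives `o((log a)²)`.

Two facts about the medium carry the lower bounds. First, `Rhat0_pos`: by Cauchy–Schwarz for long
parallel segments, the integral of the autocorrelation along any line is at most the one through the
origin; if that were not positive, all would vanish, and Abel inversion would contradict `R 0 = 1`.
Second, `coneCov_cos_mul_le`: along a fan of equally spaced directions the triangle inequality
bounds the variance of a difference at a small angle below by a fixed fraction of the one at a
multiple of that angle, where the two segments are nearly decorrelated. -/

noncomputable section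

namespace RandomPhase

/-! ### Segment integrals of the field as vectors of `L²(P)`, and their covariances -/

/-- The integral of the field over the segment of length `T` from `a` in direction `u`. -/
def lineIntegral {Ω : Type*} (μ : Space → Ω → ℝ) (a u : Space) (T : ℝ) (ω : Ω) : ℝ :=
  ∫ t in (0 : ℝ)..T, μ (a + t • u) ω

lemma pathIntegral_eq_lineIntegral {Ω : Type*} (μ : Space → Ω → ℝ) {l : ℝ} (hl : 0 < l)
    {x y : Space} (hxy : x ≠ y) (ω : Ω) :
    pathIntegral μ l x y ω =
      l * lineIntegral μ ((1 / l) • x) ((1 / ‖x - y‖) • (y - x)) (‖x - y‖ / l) ω := by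
  have hd : 0 < ‖x - y‖ := norm_pos_iff.2 (sub_ne_zero.2 hxy)
  unfold pathIntegral lineIntegral
  have h := intervalIntegral.integral_comp_mul_right (a := 0) (b := 1)
    (fun t => μ ((1 / l) • x + t • ((1 / ‖x - y‖) • (y - x))) ω) (c := ‖x - y‖ / l)
    (by positivity)
  have e : ∀ s : ℝ, (s / l) • (y - x) = (s * (‖x - y‖ / l)) • ((1 / ‖x - y‖) • (y - x)) := by
    intro s
    rw [smul_smul]
    congr 1
    field_simp
  simp_rw [e, h]
  simp only [zero_mul, one_mul, smul_eq_mul]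
  field_simp

/-- `integral_prod_mul` needs no integrability, so this holds for every `ω`, even on exceptional
realizations where the field is not integrable along the segment. -/
lemma lineIntegral_mul_lineIntegral {Ω : Type*} (μ : Space → Ω → ℝ) (a u a' u' : Space) {T T' : ℝ}
    (hT : 0 ≤ T) (hT' : 0 ≤ T') (ω : Ω) :
    lineIntegral μ a u T ω * lineIntegral μ a' u' T' ω =
      ∫ q : ℝ × ℝ, μ (a + q.1 • u) ω * μ (a' + q.2 • u') ω
        ∂((volume.restrict (Set.Ioc 0 T)).prod (volume.restrict (Set.Ioc 0 T'))) := by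
  unfold lineIntegral
  rw [integral_prod_mul (fun t => μ (a + t • u) ω) fun t => μ (a' + t • u') ω,
    intervalIntegral.integral_of_le hT, intervalIntegral.integral_of_le hT']

namespace IsRandomMedium

variable {Ω : Type*} [MeasurableSpace Ω] {P : Measure Ω}
  {μ : Space → Ω → ℝ} {R : ℝ → ℝ} {l : ℝ}

lemma integral_abs_mul_le_one (hμ : IsRandomMedium P μ R l) (x y : Space) :
    ∫ ω, ‖μ x ω * μ y ω‖ ∂P ≤ 1 := by
  have h : ∀ x, ∫ ω, μ x ω ^ 2 ∂P = 1 := fun x => by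
    simpa [sq, hμ.normalized] using hμ.autocorrelation x x
  have hi : ∀ x, Integrable (fun ω => μ x ω ^ 2) P := fun x => (hμ.memLp x).integrable_sq
  calc ∫ ω, ‖μ x ω * μ y ω‖ ∂P ≤ ∫ ω, (μ x ω ^ 2 + μ y ω ^ 2) / 2 ∂P := by
        refine integral_mono ((hμ.memLp x).integrable_mul (hμ.memLp y)).norm
          (((hi x).add (hi y)).div_const 2) fun ω => ?_
        simp only [norm_mul, Real.norm_eq_abs]
        nlinarith [sq_nonneg (|μ x ω| - |μ y ω|), sq_abs (μ x ω), sq_abs (μ y ω)]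
    _ = 1 := by
        rw [integral_div, integral_add (hi x) (hi y), h, h]; norm_num

/-- At each pair of points the absolute moment is at most one, and the rectangle of parameters has
finite measure. This licenses Fubini for all covariances below. -/
lemma integrable_prod_segments [IsProbabilityMeasure P]
    (hμ : IsRandomMedium P μ R l) (a u a' u' : Space) (T T' : ℝ) :
    Integrable (fun q : Ω × (ℝ × ℝ) => μ (a + q.2.1 • u) q.1 * μ (a' + q.2.2 • u') q.1)
      (P.prod ((volume.restrict (Set.Ioc 0 T)).prod (volume.restrict (Set.Ioc 0 T')))) := by
  have hm : Measurable
      (fun q : Ω × (ℝ × ℝ) => μ (a + q.2.1 • u) q.1 * μ (a' + q.2.2 • u') q.1) := by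
    have h1 : Measurable fun q : Ω × (ℝ × ℝ) => ((a + q.2.1 • u, q.1) : Space × Ω) := by fun_prop
    have h2 : Measurable fun q : Ω × (ℝ × ℝ) => ((a' + q.2.2 • u', q.1) : Space × Ω) := by fun_prop
    exact (hμ.measurable.comp h1).mul (hμ.measurable.comp h2)
  rw [integrable_prod_iff' hm.aestronglyMeasurable]
  refine ⟨.of_forall fun t => (hμ.memLp (a + t.1 • u)).integrable_mul (hμ.memLp (a' + t.2 • u')), ?_⟩
  refine Integrable.of_bound (C := 1) ?_ (.of_forall fun t => ?_)
  · exact (hm.aestronglyMeasurable.norm.prod_swap).integral_prod_right'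
  · rw [Real.norm_of_nonneg (integral_nonneg fun _ => norm_nonneg _)]
    exact hμ.integral_abs_mul_le_one (a + t.1 • u) (a' + t.2 • u')

lemma measurable_lineIntegral (hμ : IsRandomMedium P μ R l) (a u : Space) (T : ℝ) :
    StronglyMeasurable (lineIntegral μ a u T) := by
  have hm : Measurable (Function.uncurry fun (ω : Ω) (t : ℝ) => μ (a + t • u) ω) := by
    have h1 : Measurable fun q : Ω × ℝ => ((a + q.2 • u, q.1) : Space × Ω) := by fun_prop
    exact hμ.measurable.comp h1
  unfold lineIntegral intervalIntegral
  exact (hm.stronglyMeasurable.integral_prod_right).sub (hm.stronglyMeasurable.integral_prod_right)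

lemma memLp_lineIntegral [IsProbabilityMeasure P]
    (hμ : IsRandomMedium P μ R l) (a u : Space) {T : ℝ} (hT : 0 ≤ T) :
    MemLp (lineIntegral μ a u T) 2 P := by
  rw [memLp_two_iff_integrable_sq (hμ.measurable_lineIntegral a u T).aestronglyMeasurable]
  have h := (hμ.integrable_prod_segments a u a u T T).integral_prod_left
  refine h.congr (.of_forall fun ω => ?_)
  dsimp only
  rw [sq, lineIntegral_mul_lineIntegral μ a u a u hT hT]

/-- `R` is controlled on `[0, ∞)` only; its even extension `fun t => R |t|` serves as kernel on the
whole line from here on. -/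
lemma continuous_abs (hμ : IsRandomMedium P μ R l) : Continuous fun t => R |t| :=
  hμ.continuousOn.comp_continuous _root_.continuous_abs fun t => abs_nonneg t

lemma integral_lineIntegral_mul [IsProbabilityMeasure P]
    (hμ : IsRandomMedium P μ R l) (a u a' u' : Space) {T T' : ℝ}
    (hT : 0 ≤ T) (hT' : 0 ≤ T') :
    ∫ ω, lineIntegral μ a u T ω * lineIntegral μ a' u' T' ω ∂P =
      ∫ t in (0 : ℝ)..T, ∫ t' in (0 : ℝ)..T', R ‖a + t • u - (a' + t' • u')‖ := by
  simp_rw [lineIntegral_mul_lineIntegral μ a u a' u' hT hT']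
  have hi := hμ.integrable_prod_segments a u a' u' T T'
  rw [integral_integral_swap (f := fun ω (q : ℝ × ℝ) =>
    μ (a + q.1 • u) ω * μ (a' + q.2 • u') ω) hi]
  simp_rw [hμ.autocorrelation]
  rw [integral_prod, intervalIntegral.integral_of_le hT]
  · simp_rw [intervalIntegral.integral_of_le hT']
  · have h := hi.integral_prod_right
    simp_rw [hμ.autocorrelation] at h
    exact h

lemma integral_lineIntegral [IsProbabilityMeasure P]
    (hμ : IsRandomMedium P μ R l) (a u : Space) {T : ℝ} (hT : 0 ≤ T) :
    ∫ ω, lineIntegral μ a u T ω ∂P = 0 := by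
  unfold lineIntegral
  simp_rw [intervalIntegral.integral_of_le hT]
  rw [integral_integral_swap]
  · simp [hμ.mean_zero]
  · have hm : Measurable (Function.uncurry fun (ω : Ω) (t : ℝ) => μ (a + t • u) ω) := by
      have h1 : Measurable fun q : Ω × ℝ => ((a + q.2 • u, q.1) : Space × Ω) := by fun_prop
      exact hμ.measurable.comp h1
    rw [integrable_prod_iff' hm.aestronglyMeasurable]
    refine ⟨.of_forall fun t => (hμ.memLp (a + t • u)).integrable (by norm_num), ?_⟩
    refine Integrable.of_bound (C := 1) ?_ (.of_forall fun t => ?_)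
    · exact (hm.aestronglyMeasurable.norm.prod_swap).integral_prod_right'
    · rw [Real.norm_of_nonneg (integral_nonneg fun _ => norm_nonneg _)]
      have h2 : ∫ ω, μ (a + t • u) ω ^ 2 ∂P = 1 := by
        simpa [sq, hμ.normalized] using hμ.autocorrelation (a + t • u) (a + t • u)
      calc ∫ ω, ‖μ (a + t • u) ω‖ ∂P ≤ ∫ ω, (1 + μ (a + t • u) ω ^ 2) / 2 ∂P := by
            refine integral_mono ((hμ.memLp _).integrable (by norm_num)).norm
              (((integrable_const 1).add (hμ.memLp _).integrable_sq).div_const 2) fun ω => ?_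
            simp only [Real.norm_eq_abs]
            nlinarith [sq_nonneg (|μ (a + t • u) ω| - 1), sq_abs (μ (a + t • u) ω)]
        _ = 1 := by
            rw [integral_div, integral_add (integrable_const 1) (hμ.memLp _).integrable_sq, h2]
            norm_num

/-- The integral over a segment as a vector of the Hilbert space of square-integrable random
variables. -/
def segment [IsProbabilityMeasure P]
    (hμ : IsRandomMedium P μ R l) (a u : Space) {T : ℝ} (hT : 0 ≤ T) : Lp ℝ 2 P :=
  (hμ.memLp_lineIntegral a u hT).toLp

lemma inner_segment [IsProbabilityMeasure P]
    (hμ : IsRandomMedium P μ R l) (a u a' u' : Space) {T T' : ℝ}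
    (hT : 0 ≤ T) (hT' : 0 ≤ T') :
    inner ℝ (hμ.segment a u hT) (hμ.segment a' u' hT') =
      ∫ t in (0 : ℝ)..T, ∫ t' in (0 : ℝ)..T', R ‖a + t • u - (a' + t' • u')‖ := by
  rw [← hμ.integral_lineIntegral_mul a u a' u' hT hT', L2.inner_def]
  refine integral_congr_ae ?_
  filter_upwards [(hμ.memLp_lineIntegral a u hT).coeFn_toLp,
    (hμ.memLp_lineIntegral a' u' hT').coeFn_toLp] with ω h1 h2
  simp only [segment, h1, h2, RCLike.inner_apply, conj_trivial]
  ring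

end IsRandomMedium

/-! ### Integrals of exponentially decaying kernels over squares and cones -/

section ExpDecay

variable {f : ℝ → ℝ} {C c : ℝ}

lemma integrable_exp_neg_mul_abs (hc : 0 < c) : Integrable fun t : ℝ => Real.exp (-c * |t|) := by
  rw [← integrableOn_univ, ← Set.Iic_union_Ioi (a := (0 : ℝ))]
  refine IntegrableOn.union ?_ ?_
  · refine (integrableOn_exp_mul_Iic hc 0).congr_fun (fun t ht => ?_) measurableSet_Iic
    dsimp only
    rw [abs_of_nonpos ht]; ring_nf
  · refine (exp_neg_integrableOn_Ioi 0 hc).congr_fun (fun t ht => ?_) measurableSet_Ioi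
    dsimp only
    rw [abs_of_pos ht]

lemma integral_exp_neg_mul_abs (hc : 0 < c) : ∫ t : ℝ, Real.exp (-c * |t|) = 2 / c := by
  rw [integral_comp_abs (f := fun t => Real.exp (-c * t)), integral_exp_mul_Ioi (by linarith)]
  simp; field_simp

lemma abs_intervalIntegral_le {f g : ℝ → ℝ} {a b : ℝ} (hab : a ≤ b) (hg : Continuous g)
    (h : ∀ t ∈ Set.Ioc a b, |f t| ≤ g t) : |∫ t in a..b, f t| ≤ ∫ t in a..b, g t := by
  rw [← Real.norm_eq_abs]
  exact intervalIntegral.norm_integral_le_of_norm_le (μ := volume) hab (.of_forall h)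
    (hg.intervalIntegrable _ _)

lemma nonneg_of_expDecay (hd : ∀ t, |f t| ≤ C * Real.exp (-c * |t|)) : 0 ≤ C := by
  have := (abs_nonneg _).trans (hd 0)
  simpa using this

lemma integrable_of_expDecay (hf : Continuous f) (hc : 0 < c)
    (hd : ∀ t, |f t| ≤ C * Real.exp (-c * |t|)) : Integrable f :=
  ((integrable_exp_neg_mul_abs hc).const_mul C).mono' hf.aestronglyMeasurable
    (.of_forall fun t => by simpa using hd t)

lemma abs_integral_Ioi_le_of_expDecay (hc : 0 < c)
    (hd : ∀ t, |f t| ≤ C * Real.exp (-c * |t|)) {a : ℝ} (ha : 0 ≤ a) :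
    |∫ t in Set.Ioi a, f t| ≤ C / c * Real.exp (-c * a) := by
  have h1 : ∫ t in Set.Ioi a, C * Real.exp (-c * t) = C / c * Real.exp (-c * a) := by
    rw [integral_const_mul, integral_exp_mul_Ioi (by linarith)]
    field_simp
  rw [← h1]
  rw [← Real.norm_eq_abs]
  refine norm_integral_le_of_norm_le (((exp_neg_integrableOn_Ioi a hc)).const_mul C) ?_
  filter_upwards [ae_restrict_mem measurableSet_Ioi] with t ht
  have := hd t
  rwa [abs_of_pos (ha.trans_lt ht)] at this

lemma intervalIntegral_exp_le (hc : 0 < c) {T : ℝ} (hT : 0 ≤ T) :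
    ∫ t in (0 : ℝ)..T, Real.exp (-c * t) ≤ 1 / c := by
  have h : ∫ t in Set.Ioi (0 : ℝ), Real.exp (-c * t) = 1 / c := by
    rw [integral_exp_mul_Ioi (by linarith)]; simp
  rw [← h, intervalIntegral.integral_of_le hT]
  exact setIntegral_mono_set (exp_neg_integrableOn_Ioi 0 hc)
    (.of_forall fun t => (Real.exp_pos _).le) Set.Ioc_subset_Ioi_self.eventuallyLE

/-- The double integral of a stationary kernel over a square grows linearly. -/
lemma abs_integral_square_sub_le (hf : Continuous f) (hc : 0 < c)
    (hd : ∀ t, |f t| ≤ C * Real.exp (-c * |t|)) {T : ℝ} (hT : 0 ≤ T) :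
    |(∫ t in (0 : ℝ)..T, ∫ t' in (0 : ℝ)..T, f (t' - t)) - T * ∫ t, f t| ≤ 2 * C / c ^ 2 := by
  have hC := nonneg_of_expDecay hd
  have hi := integrable_of_expDecay hf hc hd
  have hdn : ∀ t, |f (-t)| ≤ C * Real.exp (-c * |t|) := fun t => by simpa using hd (-t)
  have hcont : Continuous fun t : ℝ => ∫ t' in (0 : ℝ)..T, f (t' - t) := by
    refine intervalIntegral.continuous_parametric_intervalIntegral_of_continuous' ?_ 0 T
    fun_prop
  have h1 : (∫ t in (0 : ℝ)..T, ∫ t' in (0 : ℝ)..T, f (t' - t)) - T * ∫ t, f t =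
      ∫ t in (0 : ℝ)..T, ((∫ t' in (0 : ℝ)..T, f (t' - t)) - ∫ t, f t) := by
    rw [intervalIntegral.integral_sub (hcont.intervalIntegrable _ _)
      intervalIntegrable_const]
    simp
  -- The window `[-t, T - t]` misses two tails of the line, exponentially small in `t` and in `T -
  -- t`; integrated over `t` they stay bounded uniformly in `T`.
  have hb : ∀ t ∈ Set.Ioc 0 T, |(∫ t' in (0 : ℝ)..T, f (t' - t)) - ∫ t, f t| ≤
      C / c * Real.exp (-c * t) + C / c * Real.exp (-c * (T - t)) := by
    intro t ht
    rw [intervalIntegral.integral_comp_sub_right (fun x => f x) t]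
    have e1 : ∫ x, f x = (∫ x in Set.Iic (0 - t), f x) + (∫ x in (0 - t)..(T - t), f x) +
        ∫ x in Set.Ioi (T - t), f x := by
      rw [← intervalIntegral.integral_Iic_sub_Iic hi.integrableOn hi.integrableOn,
        ← intervalIntegral.integral_Iic_add_Ioi (b := T - t) hi.integrableOn hi.integrableOn]
      ring
    have e2 : ∫ x in Set.Iic (0 - t), f x = ∫ x in Set.Ioi t, f (-x) := by
      rw [integral_comp_neg_Ioi t f]; simp
    rw [e1, e2]
    have b1 := abs_integral_Ioi_le_of_expDecay hc hdn ht.1.le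
    have b2 := abs_integral_Ioi_le_of_expDecay hc hd (sub_nonneg.2 ht.2)
    rw [abs_le] at *
    constructor <;> linarith
  rw [h1]
  have ii : ∀ g : ℝ → ℝ, Continuous g → IntervalIntegrable g volume 0 T :=
    fun g hg => hg.intervalIntegrable _ _
  have h2 := abs_intervalIntegral_le hT (by fun_prop) hb
  refine h2.trans ?_
  rw [intervalIntegral.integral_add (ii _ (by fun_prop)) (ii _ (by fun_prop)),
    intervalIntegral.integral_const_mul, intervalIntegral.integral_const_mul,
    intervalIntegral.integral_comp_sub_left (fun x => Real.exp (-c * x))]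
  simp only [sub_self, sub_zero]
  have h3 := mul_le_mul_of_nonneg_left (intervalIntegral_exp_le hc hT) (div_nonneg hC hc.le)
  calc _ ≤ C / c * (1 / c) + C / c * (1 / c) := add_le_add h3 h3
    _ = 2 * C / c ^ 2 := by field_simp; ring

lemma intervalIntegral_exp_abs_sub_le (hc : 0 < c) {T : ℝ} (hT : 0 ≤ T) (a : ℝ) :
    ∫ t in (0 : ℝ)..T, Real.exp (-c * |t - a|) ≤ 2 / c := by
  have hi := integrable_exp_neg_mul_abs hc
  rw [intervalIntegral.integral_comp_sub_right (fun x => Real.exp (-c * |x|)) a,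
    ← integral_exp_neg_mul_abs hc, intervalIntegral.integral_of_le (by linarith)]
  exact setIntegral_le_integral hi (.of_forall fun t => (Real.exp_pos _).le)

/-- The covariance of the integrals of a field with autocorrelation function `f` over two segments
of lengths `T` and `T'` that issue from one point at an angle of cosine `k`. -/
def coneCov (f : ℝ → ℝ) (T T' k : ℝ) : ℝ :=
  ∫ t in (0 : ℝ)..T, ∫ t' in (0 : ℝ)..T', f (√(t ^ 2 + t' ^ 2 - 2 * t * t' * k))

lemma continuous_coneCov_inner (hf : Continuous f) (T' k : ℝ) :
    Continuous fun t : ℝ => ∫ t' in (0 : ℝ)..T', f (√(t ^ 2 + t' ^ 2 - 2 * t * t' * k)) := by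
  refine intervalIntegral.continuous_parametric_intervalIntegral_of_continuous' ?_ 0 T'
  fun_prop

/-- With `k` and `s` the cosine and sine of the angle, the distance of the two points is `√((t' - t
k)² + (t s)²)`, hence at least `(|t' - t k| + t s) / 2`. One half of the exponent makes the integral
over `t'` converge, the other remains as decay in `t`. The case `s = 0` is allowed and gives a bound
uniform in the angle. -/
lemma abs_coneCov_inner_le (hc : 0 < c)
    (hd : ∀ t, |f t| ≤ C * Real.exp (-c * |t|)) {T' k s t : ℝ} (hT' : 0 ≤ T') (hs : 0 ≤ s)
    (hks : k ^ 2 + s ^ 2 = 1) (ht : 0 ≤ t) :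
    |∫ t' in (0 : ℝ)..T', f (√(t ^ 2 + t' ^ 2 - 2 * t * t' * k))| ≤
      4 * C / c * Real.exp (-(c * s / 2) * t) := by
  have hC := nonneg_of_expDecay hd
  have hb : ∀ t', |f (√(t ^ 2 + t' ^ 2 - 2 * t * t' * k))| ≤
      C * Real.exp (-(c * s / 2) * t) * Real.exp (-(c / 2) * |t' - t * k|) := by
    intro t'
    refine (hd _).trans ?_
    rw [mul_assoc C, ← Real.exp_add]
    refine mul_le_mul_of_nonneg_left (Real.exp_le_exp.2 ?_) hC
    have h1 : (|t' - t * k| + t * s) / 2 ≤ √(t ^ 2 + t' ^ 2 - 2 * t * t' * k) := by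
      apply Real.le_sqrt_of_sq_le
      have h2 : t ^ 2 + t' ^ 2 - 2 * t * t' * k = |t' - t * k| ^ 2 + (t * s) ^ 2 := by
        rw [sq_abs]
        have : t ^ 2 = t ^ 2 * (k ^ 2 + s ^ 2) := by rw [hks]; ring
        linear_combination this
      rw [h2]
      have := mul_nonneg ht hs
      nlinarith [sq_nonneg (|t' - t * k| - t * s), sq_nonneg (|t' - t * k|), sq_nonneg (t * s)]
    rw [abs_of_nonneg (Real.sqrt_nonneg _)]
    nlinarith
  have h := abs_intervalIntegral_le hT' (by fun_prop) fun t' _ => hb t'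
  refine h.trans ?_
  rw [intervalIntegral.integral_const_mul]
  have h1 := mul_le_mul_of_nonneg_left
    (intervalIntegral_exp_abs_sub_le (c := c / 2) (by positivity) hT' (t * k))
    (mul_nonneg hC (Real.exp_pos (-(c * s / 2) * t)).le)
  refine h1.trans_eq ?_
  field_simp; ring

/-- Segments that issue from one point at a fixed angle have bounded covariance. -/
lemma abs_coneCov_le (hc : 0 < c)
    (hd : ∀ t, |f t| ≤ C * Real.exp (-c * |t|)) {T T' k s : ℝ} (hT : 0 ≤ T) (hT' : 0 ≤ T')
    (hs : 0 < s) (hks : k ^ 2 + s ^ 2 = 1) :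
    |coneCov f T T' k| ≤ 8 * C / (c ^ 2 * s) := by
  have hC := nonneg_of_expDecay hd
  have h := abs_intervalIntegral_le hT (by fun_prop)
    fun t ht => abs_coneCov_inner_le hc hd hT' hs.le hks ht.1.le
  refine h.trans ?_
  rw [intervalIntegral.integral_const_mul]
  have h1 := mul_le_mul_of_nonneg_left
    (intervalIntegral_exp_le (c := c * s / 2) (by positivity) hT)
    (show 0 ≤ 4 * C / c by positivity)
  refine h1.trans_eq ?_
  field_simp; ring

/-- Allows paths of slightly different lengths to be compared as if the lengths were equal, at a
cost independent of the angle. -/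
lemma abs_coneCov_sub_le (hf : Continuous f) (hc : 0 < c)
    (hd : ∀ t, |f t| ≤ C * Real.exp (-c * |t|)) {T₁ T₂ T' k : ℝ} (hT₁ : 0 ≤ T₁) (hT₂ : 0 ≤ T₂)
    (hT' : 0 ≤ T') (hk : k ^ 2 ≤ 1) :
    |coneCov f T₁ T' k - coneCov f T₂ T' k| ≤ 4 * C / c * |T₁ - T₂| := by
  have hC := nonneg_of_expDecay hd
  have hcont := continuous_coneCov_inner hf T' k
  unfold coneCov
  rw [intervalIntegral.integral_interval_sub_left (hcont.intervalIntegrable _ _)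
    (hcont.intervalIntegrable _ _), ← Real.norm_eq_abs]
  refine intervalIntegral.norm_integral_le_of_norm_le_const fun t ht => ?_
  have ht0 : 0 ≤ t := (le_min hT₂ hT₁).trans ht.1.le
  have h := abs_coneCov_inner_le hc hd (k := k) hT' (s := √(1 - k ^ 2)) (Real.sqrt_nonneg _)
    (by rw [Real.sq_sqrt (by linarith)]; ring) ht0
  refine h.trans ?_
  have h1 : Real.exp (-(c * √(1 - k ^ 2) / 2) * t) ≤ 1 := by
    rw [Real.exp_le_one_iff]
    have : 0 ≤ c * √(1 - k ^ 2) / 2 * t := by positivity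
    linarith
  exact mul_le_of_le_one_right (by positivity) h1

/-- The integral of an isotropic function along a line at distance `p` from the origin. -/
def lineTransform (f : ℝ → ℝ) (p : ℝ) : ℝ := ∫ t, f (√(t ^ 2 + p ^ 2))

lemma expDecay_line (hc : 0 < c) (hd : ∀ t, |f t| ≤ C * Real.exp (-c * |t|)) (p : ℝ) :
    ∀ t, |f (√(t ^ 2 + p ^ 2))| ≤ C * Real.exp (-c * |t|) := by
  intro t
  have hC := nonneg_of_expDecay hd
  refine (hd _).trans (mul_le_mul_of_nonneg_left (Real.exp_le_exp.2 ?_) hC)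
  have : |t| ≤ |√(t ^ 2 + p ^ 2)| := by
    rw [abs_of_nonneg (Real.sqrt_nonneg _)]
    exact Real.abs_le_sqrt (by nlinarith [sq_nonneg p])
  nlinarith

end ExpDecay

/-! ### Injectivity of the line transform on isotropic functions -/

section ExpDecay

variable {f : ℝ → ℝ} {C c : ℝ}

/-- The integral of the isotropic function over a plane at height `q` is computed twice: by lines,
where it vanishes, and in polar coordinates. -/
lemma integral_Ioi_mul_eq_zero_of_lineTransform (hf : Continuous f) (hc : 0 < c)
    (hd : ∀ t, |f t| ≤ C * Real.exp (-c * |t|)) (h0 : ∀ p, lineTransform f p = 0) (q : ℝ) :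
    ∫ ρ in Set.Ioi (0 : ℝ), ρ * f (√(ρ ^ 2 + q ^ 2)) = 0 := by
  have hC := nonneg_of_expDecay hd
  set F : ℝ × ℝ → ℝ := fun p => f (√(p.2 ^ 2 + (p.1 ^ 2 + q ^ 2))) with hF
  have hFi : Integrable F (volume.prod volume) := by
    have h := (integrable_exp_neg_mul_abs (c := c / 2) (by positivity)).mul_prod
      (integrable_exp_neg_mul_abs (c := c / 2) (by positivity))
    refine (h.const_mul C).mono' (Continuous.aestronglyMeasurable (by fun_prop))
      (.of_forall fun p => ?_)
    rw [Real.norm_eq_abs]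
    refine (hd _).trans ?_
    rw [← Real.exp_add]
    refine mul_le_mul_of_nonneg_left (Real.exp_le_exp.2 ?_) hC
    rw [abs_of_nonneg (Real.sqrt_nonneg _)]
    have : (|p.1| + |p.2|) / 2 ≤ √(p.2 ^ 2 + (p.1 ^ 2 + q ^ 2)) := by
      apply Real.le_sqrt_of_sq_le
      nlinarith [sq_nonneg (|p.1| - |p.2|), sq_abs p.1, sq_abs p.2, sq_nonneg q]
    nlinarith
  have h1 : ∫ p, F p = 0 := by
    rw [Measure.volume_eq_prod, integral_prod F hFi]
    refine integral_eq_zero_of_ae (.of_forall fun y => ?_)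
    -- A line with offset `y` inside the plane at height `q` is at distance `√(y² + q²)` from the
    -- origin.
    have := h0 (√(y ^ 2 + q ^ 2))
    rw [lineTransform, Real.sq_sqrt (by positivity)] at this
    exact this
  rw [← integral_comp_polarCoord_symm, polarCoord_target] at h1
  have h2 : ∫ p in Set.Ioi (0 : ℝ) ×ˢ Set.Ioo (-Real.pi) Real.pi,
      (p.1 * f (√(p.1 ^ 2 + q ^ 2))) * 1 = 0 := by
    refine Eq.trans ?_ h1
    refine integral_congr_ae (.of_forall fun p => ?_)
    simp only [hF, polarCoord_symm_apply, smul_eq_mul, mul_one]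
    congr 3
    have := Real.sin_sq_add_cos_sq p.2
    linear_combination (-p.1 ^ 2) * this
  rw [Measure.volume_eq_prod, setIntegral_prod_mul
    (fun ρ => ρ * f (√(ρ ^ 2 + q ^ 2))) (fun _ : ℝ => (1 : ℝ))] at h2
  refine (mul_eq_zero.1 h2).resolve_right ?_
  simp [Real.pi_pos.le, Real.pi_ne_zero]

lemma expDecay_mul_id (hc : 0 < c) (hd : ∀ t, |f t| ≤ C * Real.exp (-c * |t|)) (t : ℝ) :
    |t * f t| ≤ 2 * C / c * Real.exp (-(c / 2) * |t|) := by
  rw [abs_mul]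
  have h1 : |t| ≤ 2 / c * Real.exp (c / 2 * |t|) := by
    have := Real.add_one_le_exp (c / 2 * |t|)
    rw [div_mul_eq_mul_div, le_div_iff₀ hc]
    nlinarith
  calc |t| * |f t| ≤ (2 / c * Real.exp (c / 2 * |t|)) * (C * Real.exp (-c * |t|)) :=
        mul_le_mul h1 (hd t) (abs_nonneg _) (by positivity)
    _ = 2 * C / c * (Real.exp (c / 2 * |t|) * Real.exp (-c * |t|)) := by ring
    _ = _ := by rw [← Real.exp_add]; ring_nf

/-- An isotropic function of the plane is determined by its integrals over lines. -/
lemma eq_zero_of_lineTransform_eq_zero (hf : Continuous f) (hc : 0 < c)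
    (hd : ∀ t, |f t| ≤ C * Real.exp (-c * |t|)) (h0 : ∀ p, lineTransform f p = 0) : f 0 ≤ 0 := by
  by_contra! hpos
  have hC := nonneg_of_expDecay hd
  obtain ⟨δ, hδ, hfδ⟩ : ∃ δ > 0, ∀ t, |t| < δ → 0 < f t := by
    have := hf.continuousAt.eventually (lt_mem_nhds hpos)
    obtain ⟨δ, hδ, h⟩ := Metric.eventually_nhds_iff.1 this
    exact ⟨δ, hδ, fun t ht => h (by simpa using ht)⟩
  set q := δ / 2
  have hq : 0 < q := by positivity
  have hxf : (Integrable fun t : ℝ => t * f t) :=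
    integrable_of_expDecay (by fun_prop) (by positivity) (expDecay_mul_id hc hd)
  -- The substitution `t = √(ρ² + b²)` turns the planar integral into a tail of `t f(t)`. Since all
  -- tails vanish, so does the integral over `[0, q]`, where the integrand is positive.
  have hsub : ∀ b : ℝ, 0 ≤ b → ∫ t in Set.Ioi b, t * f t = 0 := by
    intro b hb
    have h1 := integral_Ioi_mul_eq_zero_of_lineTransform hf hc hd h0 b
    have hpos : ∀ ρ ∈ Set.Ioi (0 : ℝ), 0 < ρ ^ 2 + b ^ 2 := fun ρ hρ => by
      have : 0 < ρ := hρ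
      positivity
    have key := integral_comp_mul_deriv_Ioi (f := fun ρ => √(ρ ^ 2 + b ^ 2))
      (f' := fun ρ => ρ / √(ρ ^ 2 + b ^ 2)) (g := fun t => t * f t) (a := 0)
      (Continuous.continuousOn (by fun_prop)) ?_ ?_
      (Continuous.continuousOn (by fun_prop)) hxf.integrableOn ?_
    · simp only [Function.comp_def, ne_eq, OfNat.ofNat_ne_zero, not_false_eq_true, zero_pow,
        zero_add, Real.sqrt_sq hb] at key
      rw [← key]
      refine Eq.trans ?_ h1
      refine setIntegral_congr_fun measurableSet_Ioi fun ρ hρ => ?_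
      have := Real.sqrt_pos.2 (hpos ρ hρ)
      field_simp
    · refine tendsto_atTop_mono (fun ρ => ?_) tendsto_id
      exact Real.le_sqrt_of_sq_le (by simp only [id]; nlinarith [sq_nonneg b])
    · intro ρ hρ
      have h := ((hasDerivAt_pow 2 ρ).add_const (b ^ 2)).sqrt (hpos ρ hρ).ne'
      refine (h.congr_deriv ?_).hasDerivWithinAt
      have := Real.sqrt_pos.2 (hpos ρ hρ)
      field_simp
      simp
    · rw [integrableOn_Ici_iff_integrableOn_Ioi]
      have hi : Integrable fun ρ : ℝ => ρ * f (√(ρ ^ 2 + b ^ 2)) :=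
        integrable_of_expDecay (by fun_prop) (by positivity)
          (expDecay_mul_id hc (expDecay_line hc hd b))
      refine hi.integrableOn.congr_fun (fun ρ hρ => ?_) measurableSet_Ioi
      have := Real.sqrt_pos.2 (hpos ρ hρ)
      simp only [Function.comp_def]
      field_simp
  have h1 : ∫ t in (0 : ℝ)..q, t * f t = 0 := by
    rw [← intervalIntegral.integral_Ioi_sub_Ioi hxf.integrableOn hq.le,
      hsub 0 le_rfl, hsub q hq.le, sub_zero]
  have h2 : 0 < ∫ t in (0 : ℝ)..q, t * f t := by
    refine intervalIntegral.intervalIntegral_pos_of_pos_on (hxf.intervalIntegrable) ?_ hq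
    intro t ht
    exact mul_pos ht.1 (hfδ t (by rw [abs_of_pos ht.1]; linarith [ht.2, show q = δ / 2 from rfl]))
  exact h2.ne' h1

end ExpDecay

/-! ### Linear growth of the variance, positivity of `Rhat0`, and fans of segments -/

lemma norm_ray_sub_ray {u u' : Space} (hu : ‖u‖ = 1) (hu' : ‖u'‖ = 1) (a : Space) (t t' : ℝ) :
    ‖a + t • u - (a + t' • u')‖ = √(t ^ 2 + t' ^ 2 - 2 * t * t' * inner ℝ u u') := by
  rw [add_sub_add_left_eq_sub, ← Real.sqrt_sq (norm_nonneg (t • u - t' • u')),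
    norm_sub_sq_real, norm_smul, norm_smul, hu, hu', inner_smul_left, inner_smul_right]
  congr 1
  simp only [Real.norm_eq_abs, mul_one, sq_abs, conj_trivial]
  ring

namespace IsRandomMedium

variable {Ω : Type*} [MeasurableSpace Ω] {P : Measure Ω}
  {μ : Space → Ω → ℝ} {R : ℝ → ℝ} {l : ℝ}

lemma exists_expDecay (hμ : IsRandomMedium P μ R l) :
    ∃ C c : ℝ, 0 < c ∧ ∀ t, |R (|t|)| ≤ C * Real.exp (-c * |t|) := by
  obtain ⟨C, c, hc, hd⟩ := hμ.decay
  exact ⟨C, c, hc, fun t => hd _ (abs_nonneg t)⟩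

lemma lineTransform_zero (R : ℝ → ℝ) : lineTransform (fun t => R |t|) 0 = Rhat0 R := by
  unfold lineTransform Rhat0
  rw [← integral_comp_abs]
  simp [Real.sqrt_sq_eq_abs]

/-- The variance of the integral over a segment grows linearly with its length. -/
lemma exists_abs_coneCov_sub_le (hμ : IsRandomMedium P μ R l) :
    ∃ B : ℝ, ∀ T, 0 ≤ T → |coneCov (fun t => R |t|) T T 1 - T * Rhat0 R| ≤ B := by
  obtain ⟨C, c, hc, hd⟩ := hμ.exists_expDecay
  refine ⟨2 * C / c ^ 2, fun T hT => ?_⟩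
  have h := abs_integral_square_sub_le hμ.continuous_abs hc hd hT
  have h1 : ∫ t, R |t| = Rhat0 R := by
    rw [Rhat0, integral_comp_abs]
  rw [h1] at h
  convert h using 3
  unfold coneCov
  refine intervalIntegral.integral_congr fun t _ => intervalIntegral.integral_congr fun t' _ => ?_
  dsimp only
  congr 1
  rw [← Real.sqrt_sq_eq_abs, Real.sq_sqrt, ← Real.sqrt_sq_eq_abs]
  · congr 1; ring
  · nlinarith [sq_nonneg (t - t')]

variable [IsProbabilityMeasure P]

lemma inner_segment_cone (hμ : IsRandomMedium P μ R l) (a : Space) {u u' : Space}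
    (hu : ‖u‖ = 1) (hu' : ‖u'‖ = 1) {T T' : ℝ} (hT : 0 ≤ T) (hT' : 0 ≤ T') :
    inner ℝ (hμ.segment a u hT) (hμ.segment a u' hT') =
      coneCov (fun t => R |t|) T T' (inner ℝ u u') := by
  rw [inner_segment]
  unfold coneCov
  simp_rw [norm_ray_sub_ray hu hu', abs_of_nonneg (Real.sqrt_nonneg _)]

/-- Divided by `T`, this inner product tends to the line transform at `|q - p|`; this is how the
positive definiteness of the covariance enters. -/
lemma inner_segment_parallel (hμ : IsRandomMedium P μ R l) (p q : ℝ) {T : ℝ} (hT : 0 ≤ T) :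
    inner ℝ (hμ.segment !₂[0, p, 0] !₂[1, 0, 0] hT) (hμ.segment !₂[0, q, 0] !₂[1, 0, 0] hT) =
      ∫ t in (0 : ℝ)..T, ∫ t' in (0 : ℝ)..T, R |√((t' - t) ^ 2 + (q - p) ^ 2)| := by
  rw [inner_segment]
  have h : ∀ t t' : ℝ, ‖(!₂[0, p, 0] : Space) + t • !₂[1, 0, 0] -
      (!₂[0, q, 0] + t' • !₂[1, 0, 0])‖ = |√((t' - t) ^ 2 + (q - p) ^ 2)| := by
    intro t t'
    rw [abs_of_nonneg (Real.sqrt_nonneg _), EuclideanSpace.norm_eq]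
    congr 1
    simp [Fin.sum_univ_three]
    ring
  simp_rw [h]

/-- The spectral density of the medium at the origin is positive. -/
lemma Rhat0_pos (hμ : IsRandomMedium P μ R l) : 0 < Rhat0 R := by
  obtain ⟨C, c, hc, hd⟩ := hμ.exists_expDecay
  have hf := hμ.continuous_abs
  set f : ℝ → ℝ := fun t => R |t| with hfdef
  have hlin : ∀ p T : ℝ, 0 ≤ T → |(∫ t in (0 : ℝ)..T, ∫ t' in (0 : ℝ)..T,
      f (√((t' - t) ^ 2 + p ^ 2))) - T * lineTransform f p| ≤ 2 * C / c ^ 2 := fun p T hT =>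
    abs_integral_square_sub_le (f := fun t => f (√(t ^ 2 + p ^ 2))) (by fun_prop) hc
      (expDecay_line hc hd p) hT
  -- Cauchy–Schwarz for two parallel segments of length `T` at distance `|p|`, compared to leading
  -- order in `T`.
  have hle : ∀ p, |lineTransform f p| ≤ lineTransform f 0 := by
    intro p
    by_contra! hlt
    set g := |lineTransform f p| - lineTransform f 0 with hg
    have hgp : 0 < g := sub_pos.2 hlt
    have hC := nonneg_of_expDecay hd
    -- Long enough that `T * g` exceeds the two boundary errors `2 * C / c ^ 2` together.
    set T := (4 * C / c ^ 2 + 1) / g with hT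
    have hT0 : 0 ≤ T := by positivity
    have hTg : T * g = 4 * C / c ^ 2 + 1 := by rw [hT]; field_simp
    have h1 := hlin p T hT0
    have h2 := hlin 0 T hT0
    have hcs := abs_real_inner_le_norm (hμ.segment !₂[0, 0, 0] !₂[1, 0, 0] hT0)
      (hμ.segment !₂[0, p, 0] !₂[1, 0, 0] hT0)
    have hn : ‖hμ.segment !₂[0, p, 0] !₂[1, 0, 0] hT0‖ =
        ‖hμ.segment !₂[0, 0, 0] !₂[1, 0, 0] hT0‖ := by
      rw [norm_eq_sqrt_real_inner, norm_eq_sqrt_real_inner (hμ.segment !₂[0, 0, 0] _ hT0),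
        inner_segment_parallel, inner_segment_parallel]
      simp
    rw [hn, ← real_inner_self_eq_norm_mul_norm, inner_segment_parallel, inner_segment_parallel]
      at hcs
    simp only [sub_zero] at hcs
    replace hcs : |∫ t in (0 : ℝ)..T, ∫ t' in (0 : ℝ)..T, f (√((t' - t) ^ 2 + p ^ 2))| ≤
      ∫ t in (0 : ℝ)..T, ∫ t' in (0 : ℝ)..T, f (√((t' - t) ^ 2 + 0 ^ 2)) := hcs
    have h3 : T * |lineTransform f p| ≤ |∫ t in (0 : ℝ)..T, ∫ t' in (0 : ℝ)..T,
      f (√((t' - t) ^ 2 + p ^ 2))| + 2 * C / c ^ 2 := by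
      rw [← abs_of_nonneg hT0, ← abs_mul, abs_of_nonneg hT0]
      have := abs_sub_abs_le_abs_sub (T * lineTransform f p) (∫ t in (0 : ℝ)..T,
        ∫ t' in (0 : ℝ)..T, f (√((t' - t) ^ 2 + p ^ 2)))
      rw [abs_sub_comm] at this
      linarith
    have h4 := (abs_le.1 h2).2
    have h5 : T * |lineTransform f p| = T * g + T * lineTransform f 0 := by rw [hg]; ring
    have h6 : 4 * C / c ^ 2 = 2 * C / c ^ 2 + 2 * C / c ^ 2 := by ring
    have h7 := h3.trans (add_le_add_left hcs _)
    rw [h5, hTg, h6] at h7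
    linarith
  rw [← lineTransform_zero]
  by_contra! hneg
  have h0 : f 0 ≤ 0 := eq_zero_of_lineTransform_eq_zero hf hc hd fun p =>
    abs_eq_zero.1 (le_antisymm ((hle p).trans hneg) (abs_nonneg _))
  simp only [hfdef, abs_zero, hμ.normalized] at h0
  linarith

/-- Segments of equal length leave the origin in equally spaced directions of a plane. By isotropy
their mutual distances in `L²(P)` depend on the difference of the indices only. -/
lemma exists_fan (hμ : IsRandomMedium P μ R l) {T : ℝ} (hT : 0 ≤ T) (φ : ℝ) :
    ∃ z : ℕ → Lp ℝ 2 P, ∀ m n : ℕ, ‖z m - z n‖ ^ 2 = 2 * (coneCov (fun t => R |t|) T T 1 -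
      coneCov (fun t => R |t|) T T (Real.cos (m * φ - n * φ))) := by
  set u : ℕ → Space := fun n => !₂[Real.cos (n * φ), Real.sin (n * φ), 0] with hu
  have hinner : ∀ m n, inner ℝ (u m) (u n) = Real.cos (m * φ - n * φ) := by
    intro m n
    rw [Real.cos_sub, PiLp.inner_apply]
    simp [hu, Fin.sum_univ_three]
    ring
  have hnorm : ∀ n, ‖u n‖ = 1 := by
    intro n
    rw [norm_eq_sqrt_real_inner, hinner]; simp
  refine ⟨fun n => hμ.segment 0 (u n) hT, fun m n => ?_⟩
  rw [@norm_sub_sq_real, ← real_inner_self_eq_norm_sq, ← real_inner_self_eq_norm_sq]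
  simp only [inner_segment_cone hμ 0 (hnorm _) (hnorm _), hinner, sub_self, Real.cos_zero]
  ring

lemma coneCov_cos_le (hμ : IsRandomMedium P μ R l) {T : ℝ} (hT : 0 ≤ T) (φ : ℝ) :
    coneCov (fun t => R |t|) T T (Real.cos φ) ≤ coneCov (fun t => R |t|) T T 1 := by
  obtain ⟨z, hz⟩ := hμ.exists_fan hT φ
  have h := hz 1 0
  simp only [Nat.cast_one, one_mul, Nat.cast_zero, zero_mul, sub_zero] at h
  linarith [sq_nonneg ‖z 1 - z 0‖]

/-- The chord of a fan across `N` steps is at most `N` times one step. Read from right to left, this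
bounds the variance at a small angle below by the variance at an angle where the segments
decorrelate. -/
lemma coneCov_cos_mul_le (hμ : IsRandomMedium P μ R l) {T : ℝ} (hT : 0 ≤ T) (φ : ℝ) (N : ℕ) :
    coneCov (fun t => R |t|) T T 1 - coneCov (fun t => R |t|) T T (Real.cos (N * φ)) ≤
      (N : ℝ) ^ 2 *
        (coneCov (fun t => R |t|) T T 1 - coneCov (fun t => R |t|) T T (Real.cos φ)) := by
  obtain ⟨z, hz⟩ := hμ.exists_fan hT φ
  have hstep : ∀ n, dist (z n) (z (n + 1)) = dist (z 0) (z 1) := by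
    intro n
    rw [dist_eq_norm, dist_eq_norm, ← sq_eq_sq₀ (norm_nonneg _) (norm_nonneg _), hz, hz]
    congr 4
    push_cast
    ring
  have h := dist_le_range_sum_dist z N
  simp only [hstep, Finset.sum_const, Finset.card_range, nsmul_eq_mul] at h
  have h2 := pow_le_pow_left₀ dist_nonneg h 2
  rw [mul_pow, dist_eq_norm, dist_eq_norm, hz, hz] at h2
  simp only [Nat.cast_zero, zero_mul, zero_sub, Real.cos_neg, Nat.cast_one, one_mul] at h2
  linarith

end IsRandomMedium

/-! ### Path integrals from a common point to two targets -/

/-- The unit vector that points from `x` to `y`. -/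
def direction (x y : Space) : Space := (1 / ‖x - y‖) • (y - x)

lemma norm_direction {x y : Space} (hxy : x ≠ y) : ‖direction x y‖ = 1 := by
  have hd : 0 < ‖x - y‖ := norm_pos_iff.2 (sub_ne_zero.2 hxy)
  rw [direction, norm_smul, norm_sub_rev y x, Real.norm_of_nonneg (by positivity)]
  field_simp

lemma norm_direction_sub_le {x y y' : Space} (hx : x ≠ y) (hx' : x ≠ y') :
    ‖direction x y - direction x y'‖ ≤ 2 * ‖y - y'‖ / ‖x - y‖ := by
  have hd : 0 < ‖x - y‖ := norm_pos_iff.2 (sub_ne_zero.2 hx)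
  have hd' : 0 < ‖x - y'‖ := norm_pos_iff.2 (sub_ne_zero.2 hx')
  have e : direction x y - direction x y' = (1 / ‖x - y‖) • (y - y') +
      ((‖x - y'‖ - ‖x - y‖) / ‖x - y‖) • direction x y' := by
    unfold direction
    rw [smul_smul]
    have : (‖x - y'‖ - ‖x - y‖) / ‖x - y‖ * (1 / ‖x - y'‖) = 1 / ‖x - y‖ - 1 / ‖x - y'‖ := by
      field_simp
    rw [this]
    module
  rw [e]
  refine (norm_add_le _ _).trans ?_
  rw [norm_smul, norm_smul, norm_direction hx', Real.norm_of_nonneg (by positivity), norm_div,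
    Real.norm_of_nonneg hd.le, Real.norm_eq_abs]
  have h := abs_norm_sub_norm_le (x - y') (x - y)
  rw [sub_sub_sub_cancel_left] at h
  rw [mul_one, one_div_mul_eq_div, ← add_div]
  gcongr
  linarith

namespace IsRandomMedium

variable {Ω : Type*} [MeasurableSpace Ω] {P : Measure Ω} [IsProbabilityMeasure P]
  {μ : Space → Ω → ℝ} {R : ℝ → ℝ} {l : ℝ}

/-- The path integral from `x` to `y` as a vector of the Hilbert space of square-integrable random
variables. -/
def path (hμ : IsRandomMedium P μ R l) (hl : 0 < l) (x y : Space) : Lp ℝ 2 P :=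
  l • hμ.segment ((1 / l) • x) (direction x y) (T := ‖x - y‖ / l) (by positivity)

lemma coeFn_path (hμ : IsRandomMedium P μ R l) (hl : 0 < l) {x y : Space} (hxy : x ≠ y) :
    hμ.path hl x y =ᵐ[P] pathIntegral μ l x y := by
  have hT : 0 ≤ ‖x - y‖ / l := by positivity
  filter_upwards [(hμ.memLp_lineIntegral ((1 / l) • x) (direction x y) hT).coeFn_toLp,
    Lp.coeFn_smul l (hμ.segment ((1 / l) • x) (direction x y) hT)] with ω h1 h2
  rw [path, h2, pathIntegral_eq_lineIntegral μ hl hxy, Pi.smul_apply, segment, h1, smul_eq_mul]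
  rfl

lemma integral_pathIntegral (hμ : IsRandomMedium P μ R l) (hl : 0 < l) {x y : Space}
    (hxy : x ≠ y) : ∫ ω, pathIntegral μ l x y ω ∂P = 0 := by
  simp_rw [pathIntegral_eq_lineIntegral μ hl hxy]
  rw [integral_const_mul, hμ.integral_lineIntegral _ _ (by positivity), mul_zero]

lemma inner_path (hμ : IsRandomMedium P μ R l) (hl : 0 < l) {x y y' : Space} (hy : x ≠ y)
    (hy' : x ≠ y') : inner ℝ (hμ.path hl x y) (hμ.path hl x y') =
      l ^ 2 * coneCov (fun t => R |t|) (‖x - y‖ / l) (‖x - y'‖ / l)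
        (inner ℝ (direction x y) (direction x y')) := by
  rw [path, path, real_inner_smul_left, real_inner_smul_right,
    inner_segment_cone hμ _ (norm_direction hy) (norm_direction hy')]
  ring

lemma norm_path_sq (hμ : IsRandomMedium P μ R l) (hl : 0 < l) {x y : Space} (hy : x ≠ y) :
    ‖hμ.path hl x y‖ ^ 2 =
      l ^ 2 * coneCov (fun t => R |t|) (‖x - y‖ / l) (‖x - y‖ / l) 1 := by
  rw [← real_inner_self_eq_norm_sq, inner_path hμ hl hy hy, real_inner_self_eq_norm_sq,
    norm_direction hy]
  norm_num

lemma exists_abs_norm_path_sq_sub_le (hμ : IsRandomMedium P μ R l) (hl : 0 < l) :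
    ∃ B : ℝ, ∀ x y, x ≠ y → |‖hμ.path hl x y‖ ^ 2 - l * Rhat0 R * ‖x - y‖| ≤ B := by
  obtain ⟨B, hB⟩ := hμ.exists_abs_coneCov_sub_le
  refine ⟨l ^ 2 * B, fun x y hxy => ?_⟩
  rw [norm_path_sq hμ hl hxy]
  have e : l ^ 2 * coneCov (fun t => R |t|) (‖x - y‖ / l) (‖x - y‖ / l) 1 -
      l * Rhat0 R * ‖x - y‖ = l ^ 2 * (coneCov (fun t => R |t|) (‖x - y‖ / l) (‖x - y‖ / l) 1 -
      ‖x - y‖ / l * Rhat0 R) := by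
    field_simp
  rw [e, abs_mul, abs_of_nonneg (by positivity)]
  exact mul_le_mul_of_nonneg_left (hB _ (by positivity)) (by positivity)

/-- If the angle at `x` between the paths to `y` and `y'` is small but not too small, then the
difference of the path integrals has a variance proportional to the length. -/
lemma exists_le_coneCov_one_sub (hμ : IsRandomMedium P μ R l) {ε D : ℝ} (hε : 0 < ε)
    (hD : 0 ≤ D) :
    ∃ b > 0, ∃ B : ℝ, ∀ T φ : ℝ, 0 < T → 0 ≤ φ → T * φ ≤ D → ε ≤ T * Real.sin φ →
      b * T - B ≤ coneCov (fun t => R |t|) T T 1 - coneCov (fun t => R |t|) T T (Real.cos φ) := by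
  obtain ⟨B, hB⟩ := hμ.exists_abs_coneCov_sub_le
  obtain ⟨C, c, hc, hd⟩ := hμ.exists_expDecay
  have hC := nonneg_of_expDecay hd
  have hr := hμ.Rhat0_pos
  -- `N` is independent of `T` and `φ`. By Jordan's inequality `T sin (N φ) ≥ 2 N ε / π` as long as
  -- `N φ ≤ π / 2`, and this `N` then makes the covariance at angle `N φ` at most half of the
  -- leading term `T * Rhat0 R`.
  obtain ⟨N, hN⟩ := exists_nat_gt (8 * Real.pi * C / (c ^ 2 * ε * Rhat0 R))
  have hN0 : (0 : ℝ) < N := lt_of_le_of_lt (by positivity) hN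
  have hB0 : 0 ≤ B := (abs_nonneg _).trans (hB 0 le_rfl)
  refine ⟨Rhat0 R / (2 * N ^ 2), by positivity, B / N ^ 2 +
    Rhat0 R / (2 * N ^ 2) * (N * D), fun T φ hT hφ hTD hTε => ?_⟩
  have hfan := hμ.coneCov_cos_mul_le hT.le φ N
  have hv := abs_le.1 (hB T hT.le)
  by_cases hsmall : N * φ ≤ Real.pi / 2
  · have hsφ : Real.sin φ ≤ φ := Real.sin_le hφ
    have hφ0 : 0 < φ := by
      rcases hφ.eq_or_lt with h | h
      · rw [← h, Real.sin_zero] at hTε; linarith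
      · exact h
    have hsin : 2 / Real.pi * (N * φ) ≤ Real.sin (N * φ) :=
      Real.mul_le_sin (by positivity) hsmall
    have hsin0 : 0 < Real.sin (N * φ) := lt_of_lt_of_le (by positivity) hsin
    have hcov := abs_coneCov_le hc hd hT.le hT.le hsin0
      (Real.cos_sq_add_sin_sq (N * φ))
    have h1 : 8 * C / (c ^ 2 * Real.sin (N * φ)) ≤ Rhat0 R * T / 2 := by
      rw [div_le_iff₀ (by positivity)]
      rw [div_lt_iff₀ (by positivity)] at hN
      have h2 : 2 / Real.pi * (N * ε) ≤ T * Real.sin (N * φ) := by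
        have : 2 / Real.pi * (N * ε) ≤ T * (2 / Real.pi * (N * φ)) := by
          have : ε ≤ T * φ := hTε.trans (mul_le_mul_of_nonneg_left hsφ hT.le)
          calc 2 / Real.pi * (N * ε) ≤ 2 / Real.pi * (N * (T * φ)) := by gcongr
            _ = _ := by ring
        exact this.trans (mul_le_mul_of_nonneg_left hsin hT.le)
      have h3 : 8 * C ≤ N * (c ^ 2 * ε * Rhat0 R) / Real.pi := by
        rw [le_div_iff₀ Real.pi_pos]; linarith
      calc 8 * C ≤ N * (c ^ 2 * ε * Rhat0 R) / Real.pi := h3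
        _ = Rhat0 R * c ^ 2 / 2 * (2 / Real.pi * (N * ε)) := by field_simp
        _ ≤ Rhat0 R * c ^ 2 / 2 * (T * Real.sin (N * φ)) := by gcongr
        _ = _ := by ring
    have h4 := (abs_le.1 hcov).2
    have h5 : Rhat0 R * T / 2 - B ≤ (N : ℝ) ^ 2 * (coneCov (fun t => R |t|) T T 1 -
        coneCov (fun t => R |t|) T T (Real.cos φ)) := by linarith
    have h6 : Rhat0 R / (2 * N ^ 2) * T - B / N ^ 2 = (Rhat0 R * T / 2 - B) / N ^ 2 := by
      field_simp
    have h7 : (Rhat0 R * T / 2 - B) / N ^ 2 ≤ coneCov (fun t => R |t|) T T 1 -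
        coneCov (fun t => R |t|) T T (Real.cos φ) := by
      rw [div_le_iff₀ (by positivity)]; linarith
    have : 0 ≤ Rhat0 R / (2 * N ^ 2) * (N * D) := by positivity
    linarith
  -- Here `φ` is bounded below, so `T φ ≤ D` bounds `T` by `N * D`; the term `N * D` in the additive
  -- constant absorbs this case.
  · push Not at hsmall
    have h1 : T ≤ N * D := by
      have : 1 ≤ N * φ := by linarith [Real.pi_gt_three]
      calc T ≤ T * (N * φ) := le_mul_of_one_le_right hT.le this
        _ = N * (T * φ) := by ring
        _ ≤ N * D := by gcongr
    have h2 := hμ.coneCov_cos_le hT.le φ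
    have h3 : Rhat0 R / (2 * N ^ 2) * T ≤ Rhat0 R / (2 * N ^ 2) * (N * D) := by gcongr
    have : 0 ≤ B / (N : ℝ) ^ 2 := by positivity
    linarith

/-- The lengths of the two paths differ by at most `‖y - y'‖`, which costs only a constant, so the
equal-length bound `exists_le_coneCov_one_sub` applies. The angle at `x` is at most `π ‖y - y'‖ / ‖x
- y‖`, which supplies its parameter `D`. -/
lemma exists_le_norm_path_sub_path_sq (hμ : IsRandomMedium P μ R l) (hl : 0 < l)
    (y y' : Space) {ε : ℝ} (hε : 0 < ε) :
    ∃ b > 0, ∃ B : ℝ, ∀ x, x ≠ y → x ≠ y' →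
      ε ≤ ‖x - y‖ * √(1 - (inner ℝ (direction x y) (direction x y')) ^ 2) →
      b * ‖x - y‖ - B ≤ ‖hμ.path hl x y' - hμ.path hl x y‖ ^ 2 := by
  obtain ⟨B, hB⟩ := hμ.exists_abs_coneCov_sub_le
  obtain ⟨C, c, hc, hd⟩ := hμ.exists_expDecay
  have hC := nonneg_of_expDecay hd
  obtain ⟨b, hb, B', hB'⟩ := hμ.exists_le_coneCov_one_sub (ε := ε / l)
    (D := Real.pi * ‖y - y'‖ / l) (by positivity) (by positivity)
  have hr := hμ.Rhat0_pos
  refine ⟨2 * l * b, by positivity, l ^ 2 * (2 * B' + 2 * B + Rhat0 R * (‖y - y'‖ / l) +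
    8 * C / c * (‖y - y'‖ / l)), fun x hx hx' hs => ?_⟩
  have hd1 : 0 < ‖x - y‖ := norm_pos_iff.2 (sub_ne_zero.2 hx)
  set k := inner ℝ (direction x y) (direction x y') with hk
  set T := ‖x - y‖ / l with hT
  set T' := ‖x - y'‖ / l with hT'
  have hT0 : 0 < T := by positivity
  have hT'0 : 0 ≤ T' := by positivity
  have hk1 : |k| ≤ 1 := by
    have := abs_real_inner_le_norm (direction x y) (direction x y')
    rwa [norm_direction hx, norm_direction hx', one_mul] at this
  obtain ⟨hk2, hk3⟩ := abs_le.1 hk1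
  set φ := Real.arccos k with hφ
  have hcos : Real.cos φ = k := Real.cos_arccos hk2 hk3
  have hsin : Real.sin φ = √(1 - k ^ 2) := Real.sin_arccos k
  have hφ0 : 0 ≤ φ := Real.arccos_nonneg k
  have hφπ : φ ≤ Real.pi := Real.arccos_le_pi k
  -- The chord `2 sin (φ / 2)` of the directions is at most `2 ‖y - y'‖ / ‖x - y‖`, and Jordan's
  -- inequality compares it with `φ`.
  have hφle : φ ≤ Real.pi * ‖y - y'‖ / ‖x - y‖ := by
    have h1 := norm_direction_sub_le hx hx'
    have h2 : ‖direction x y - direction x y'‖ = 2 * Real.sin (φ / 2) := by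
      have hs0 : 0 ≤ Real.sin (φ / 2) :=
        Real.sin_nonneg_of_nonneg_of_le_pi (by linarith) (by linarith)
      rw [← sq_eq_sq₀ (norm_nonneg _) (by positivity), norm_sub_sq_real, norm_direction hx,
        norm_direction hx', ← hk, mul_pow, Real.sin_sq_eq_half_sub, mul_div_cancel₀ φ two_ne_zero, hcos]
      ring
    have h3 : 2 / Real.pi * (φ / 2) ≤ Real.sin (φ / 2) :=
      Real.mul_le_sin (by linarith) (by linarith)
    have h4 : φ = Real.pi * (2 / Real.pi * (φ / 2)) := by field_simp
    rw [h4, mul_div_assoc]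
    refine mul_le_mul_of_nonneg_left ?_ Real.pi_pos.le
    rw [h2, mul_div_assoc] at h1
    linarith
  have hmain := hB' T φ hT0 hφ0 (by
    rw [le_div_iff₀ hd1, mul_comm] at hφle
    rw [hT, div_mul_eq_mul_div]
    exact div_le_div_of_nonneg_right hφle hl.le) (by
    rw [hT, div_mul_eq_mul_div, hsin]
    gcongr)
  rw [hcos] at hmain
  have hTT : |T' - T| ≤ ‖y - y'‖ / l := by
    rw [hT, hT', ← sub_div, abs_div, abs_of_pos hl]
    gcongr
    have h := abs_norm_sub_norm_le (x - y') (x - y)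
    rwa [sub_sub_sub_cancel_left] at h
  have hcont := abs_coneCov_sub_le hμ.continuous_abs hc hd (k := k) hT'0 hT0.le hT0.le
    ((sq_le_one_iff_abs_le_one k).2 hk1)
  have e : ‖hμ.path hl x y' - hμ.path hl x y‖ ^ 2 = l ^ 2 *
      (coneCov (fun t => R |t|) T' T' 1 + coneCov (fun t => R |t|) T T 1 -
        2 * coneCov (fun t => R |t|) T' T k) := by
    rw [@norm_sub_sq_real, norm_path_sq hμ hl hx, norm_path_sq hμ hl hx', inner_path hμ hl hx' hx,
      real_inner_comm]
    ring
  rw [e]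
  have e2 : 2 * l * b * ‖x - y‖ = l ^ 2 * (2 * b * T) := by rw [hT]; field_simp
  rw [e2, ← mul_sub]
  refine mul_le_mul_of_nonneg_left ?_ (by positivity)
  have v1 := abs_le.1 (hB T hT0.le)
  have v2 := abs_le.1 (hB T' hT'0)
  have v3 := (abs_le.1 hcont).2
  have v4 : 4 * C / c * |T' - T| ≤ 4 * C / c * (‖y - y'‖ / l) := by gcongr
  have v5 : Rhat0 R * (T - T') ≤ Rhat0 R * (‖y - y'‖ / l) := by
    gcongr
    linarith [(abs_le.1 hTT).1]
  have v6 : 8 * C / c * (‖y - y'‖ / l) = 2 * (4 * C / c * (‖y - y'‖ / l)) := by ring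
  linarith [v1.1, v2.1, v1.2]

end IsRandomMedium

/-! ### Sums of the weight over sets of lattice points -/

section Lattice

/-- The Euclidean norm on the square lattice. -/
def latticeNorm (p : ℤ × ℤ) : ℝ := √((p.1 : ℝ) ^ 2 + (p.2 : ℝ) ^ 2)

lemma latticeNorm_nonneg (p : ℤ × ℤ) : 0 ≤ latticeNorm p := Real.sqrt_nonneg _

lemma latticeNorm_sq (p : ℤ × ℤ) : latticeNorm p ^ 2 = (p.1 : ℝ) ^ 2 + (p.2 : ℝ) ^ 2 :=
  Real.sq_sqrt (by positivity)

lemma abs_fst_le_latticeNorm (p : ℤ × ℤ) : |(p.1 : ℝ)| ≤ latticeNorm p :=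
  Real.abs_le_sqrt (by nlinarith [sq_nonneg (p.2 : ℝ)])

lemma abs_snd_le_latticeNorm (p : ℤ × ℤ) : |(p.2 : ℝ)| ≤ latticeNorm p :=
  Real.abs_le_sqrt (by nlinarith [sq_nonneg (p.1 : ℝ)])

lemma latticeNorm_le_add (p : ℤ × ℤ) : latticeNorm p ≤ |(p.1 : ℝ)| + |(p.2 : ℝ)| := by
  refine Real.sqrt_le_iff.2 ⟨by positivity, ?_⟩
  nlinarith [sq_abs (p.1 : ℝ), sq_abs (p.2 : ℝ), mul_nonneg (abs_nonneg (p.1 : ℝ))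
    (abs_nonneg (p.2 : ℝ))]

lemma latticeNorm_swap (p : ℤ × ℤ) : latticeNorm p.swap = latticeNorm p := by
  simp [latticeNorm, add_comm]

lemma norm_transducer {h : ℝ} (hh : 0 < h) (p : ℤ × ℤ) :
    ‖transducer h p‖ = h * latticeNorm p := by
  have h0 := latticeNorm_nonneg p
  rw [← sq_eq_sq₀ (norm_nonneg _) (by positivity), norm_transducer_sq, mul_pow, latticeNorm_sq]

/-- The lattice points in the disc of radius `ρ`. -/
def disc (ρ : ℝ) : Finset (ℤ × ℤ) := arrayLabels 1 (2 * ρ)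

lemma mem_disc {ρ : ℝ} {p : ℤ × ℤ} : p ∈ disc ρ ↔ latticeNorm p ≤ ρ := by
  rw [disc, mem_arrayLabels_iff one_pos, norm_transducer one_pos, one_mul]
  simp

lemma disc_mono {ρ ρ' : ℝ} (h : ρ ≤ ρ') : disc ρ ⊆ disc ρ' :=
  fun _ hp => mem_disc.2 ((mem_disc.1 hp).trans h)

lemma arrayLabels_eq_disc {h : ℝ} (hh : 0 < h) (a : ℝ) : arrayLabels h a = disc (a / (2 * h)) := by
  ext p
  rw [mem_arrayLabels_iff hh, mem_disc, norm_transducer hh, le_div_iff₀ two_pos,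
    le_div_iff₀ (by positivity)]
  constructor <;> intro H <;> linarith

/-- A weight on the square lattice that is comparable to the inverse square of the norm. -/
def weight (p : ℤ × ℤ) : ℝ := 1 / (1 + (p.1 : ℝ) ^ 2 + (p.2 : ℝ) ^ 2)

lemma weight_pos (p : ℤ × ℤ) : 0 < weight p := by unfold weight; positivity

lemma weight_le_one (p : ℤ × ℤ) : weight p ≤ 1 := by
  unfold weight
  rw [div_le_one (by positivity)]
  nlinarith [sq_nonneg (p.1 : ℝ), sq_nonneg (p.2 : ℝ)]

lemma weight_le_of_le {p : ℤ × ℤ} {r : ℝ} (hr : 0 < r) (h : r ≤ latticeNorm p) :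
    weight p ≤ 1 / r ^ 2 := by
  unfold weight
  refine one_div_le_one_div_of_le (by positivity) ?_
  have := pow_le_pow_left₀ hr.le h 2
  rw [latticeNorm_sq] at this
  linarith

lemma weight_swap (p : ℤ × ℤ) : weight p.swap = weight p := by
  simp [weight, add_right_comm]

lemma card_le_of_sub_le (s : Finset ℤ) {L : ℝ} (hL : 0 ≤ L)
    (h : ∀ a ∈ s, ∀ b ∈ s, (b : ℝ) - a ≤ L) : (s.card : ℝ) ≤ L + 1 := by
  rcases s.eq_empty_or_nonempty with rfl | hs
  · simp; linarith
  have hsub : s ⊆ Finset.Icc (s.min' hs) (s.max' hs) := fun x hx =>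
    Finset.mem_Icc.2 ⟨s.min'_le x hx, s.le_max' x hx⟩
  have h1 := Finset.card_le_card hsub
  rw [Int.card_Icc] at h1
  have h2 := h _ (s.min'_mem hs) _ (s.max'_mem hs)
  have h3 : s.min' hs ≤ s.max' hs := s.min'_le _ (s.max'_mem hs)
  have h4 : ((s.max' hs + 1 - s.min' hs).toNat : ℝ) = (s.max' hs : ℝ) + 1 - s.min' hs := by
    have : ((s.max' hs + 1 - s.min' hs).toNat : ℤ) = s.max' hs + 1 - s.min' hs :=
      Int.toNat_of_nonneg (by linarith)
    exact_mod_cast this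
  calc (s.card : ℝ) ≤ ((s.max' hs + 1 - s.min' hs).toNat : ℝ) := by exact_mod_cast h1
    _ ≤ L + 1 := by rw [h4]; linarith

/-- A bound for the number of points of each row gives a bound for sums over the rows. -/
lemma sum_le_sum_rows {ρ : ℝ} {S : Finset (ℤ × ℤ)} (hS : S ⊆ disc ρ) {L g : ℤ → ℝ}
    {F : ℤ × ℤ → ℝ} (hL : ∀ m, 0 ≤ L m) (hg : ∀ m, 0 ≤ g m) (hF : ∀ p ∈ S, F p ≤ g p.1)
    (h : ∀ p ∈ S, ∀ q ∈ S, p.1 = q.1 → (q.2 : ℝ) - p.2 ≤ L p.1) :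
    ∑ p ∈ S, F p ≤ ∑ m ∈ Finset.Icc (-(⌊ρ⌋₊ : ℤ)) ⌊ρ⌋₊, (L m + 1) * g m := by
  have hmaps : ∀ p ∈ S, p.1 ∈ Finset.Icc (-(⌊ρ⌋₊ : ℤ)) ⌊ρ⌋₊ := by
    intro p hp
    have h1 := (abs_fst_le_latticeNorm p).trans (mem_disc.1 (hS hp))
    have h2 : p.1.natAbs ≤ ⌊ρ⌋₊ := by
      apply Nat.le_floor
      rwa [Nat.cast_natAbs, Int.cast_abs]
    rw [Finset.mem_Icc]
    omega
  rw [← Finset.sum_fiberwise_of_maps_to hmaps]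
  refine Finset.sum_le_sum fun m _ => ?_
  have hcard : ((S.filter fun p => p.1 = m).card : ℝ) ≤ L m + 1 := by
    have hinj : Set.InjOn Prod.snd (S.filter fun p => p.1 = m : Set (ℤ × ℤ)) := by
      intro p hp q hq hpq
      simp only [Finset.coe_filter, Set.mem_ofPred_eq] at hp hq
      exact Prod.ext (hp.2.trans hq.2.symm) hpq
    rw [← Finset.card_image_of_injOn hinj]
    refine card_le_of_sub_le _ (hL m) ?_
    intro a ha b hb
    obtain ⟨p, hp, rfl⟩ := Finset.mem_image.1 ha
    obtain ⟨q, hq, rfl⟩ := Finset.mem_image.1 hb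
    rw [Finset.mem_filter] at hp hq
    have := h p hp.1 q hq.1 (hp.2.trans hq.2.symm)
    rwa [hp.2] at this
  calc ∑ p ∈ S.filter fun p => p.1 = m, F p ≤ ∑ p ∈ S.filter fun p => p.1 = m, g m := by
        refine Finset.sum_le_sum fun p hp => ?_
        rw [Finset.mem_filter] at hp
        rw [← hp.2]
        exact hF p hp.1
    _ = (S.filter fun p => p.1 = m).card * g m := by rw [Finset.sum_const, nsmul_eq_mul]
    _ ≤ (L m + 1) * g m := mul_le_mul_of_nonneg_right hcard (hg m)

lemma sum_Icc_abs_div_le (M : ℕ) :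
    ∑ m ∈ Finset.Icc (-(M : ℤ)) M, |(m : ℝ)| / (1 + (m : ℝ) ^ 2) ≤ 2 * (1 + Real.log M) := by
  rw [Finset.sum_Icc_of_even_eq_range (f := fun m : ℤ => |(m : ℝ)| / (1 + (m : ℝ) ^ 2))
    (by intro m; simp)]
  have h := harmonic_le_one_add_log M
  rw [harmonic] at h
  push_cast at h
  rw [Finset.sum_range_succ']
  simp only [Nat.cast_add, Nat.cast_one, Int.cast_add, Int.cast_natCast, Int.cast_one, nsmul_eq_mul,
    Nat.cast_ofNat, CharP.cast_eq_zero, Int.cast_zero, abs_zero, zero_div, sub_zero, add_zero]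
  refine mul_le_mul_of_nonneg_left (le_trans (Finset.sum_le_sum fun i _ => ?_) h) two_pos.le
  rw [abs_of_nonneg (by positivity), inv_eq_one_div, div_le_div_iff₀ (by positivity) (by positivity)]
  nlinarith

lemma exists_sum_Icc_le : ∃ B : ℝ, 0 ≤ B ∧ ∀ M : ℕ,
    ∑ m ∈ Finset.Icc (-(M : ℤ)) M, 1 / (1 + (m : ℝ) ^ 2) ≤ B := by
  have hs : Summable fun m : ℤ => 1 / (1 + (m : ℝ) ^ 2) := by
    have h := (Real.summable_one_div_int_pow (p := 2)).2 one_lt_two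
    have h' : Summable fun m : ℤ => 1 / (m : ℝ) ^ 2 + if m = 0 then (1 : ℝ) else 0 :=
      h.add (summable_of_ne_finset_zero (s := {0}) (by simp +contextual))
    refine Summable.of_nonneg_of_le (fun m => by positivity) (fun m => ?_) h'
    by_cases hm : m = 0
    · simp [hm]
    · have : (0 : ℝ) < (m : ℝ) ^ 2 := by positivity
      simp only [hm, if_false, add_zero]
      exact one_div_le_one_div_of_le this (by linarith)
  exact ⟨∑' m : ℤ, 1 / (1 + (m : ℝ) ^ 2), tsum_nonneg fun m => by positivity,
    fun M => hs.sum_le_tsum _ fun m _ => by positivity⟩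

/-- The weight of a set whose row over `m` has length at most `k |m| + k'`. -/
lemma exists_sum_weight_le_of_rows : ∃ B : ℝ, 0 < B ∧ ∀ ρ : ℝ, 2 ≤ ρ → ∀ k k' : ℝ, 0 ≤ k → 0 ≤ k' →
    ∀ S ⊆ disc ρ, (∀ p ∈ S, ∀ q ∈ S, p.1 = q.1 → (q.2 : ℝ) - p.2 ≤ k * |(p.1 : ℝ)| + k') →
      ∑ p ∈ S, weight p ≤ B * (k * Real.log ρ + k' + 1) := by
  obtain ⟨B, hB, hBs⟩ := exists_sum_Icc_le
  refine ⟨B + 6, by positivity, fun ρ hρ k k' hk hk' S hS h => ?_⟩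
  -- Row `m` has at most `k |m| + k' + 1` points of weight at most `1 / (1 + m²)`: the linear part
  -- sums to a logarithm, the constant part converges.
  have h1 := sum_le_sum_rows hS (L := fun m => k * |(m : ℝ)| + k')
    (g := fun m => 1 / (1 + (m : ℝ) ^ 2)) (F := weight) (fun m => by positivity)
    (fun m => by positivity) (fun p _ => by
      unfold weight
      exact one_div_le_one_div_of_le (by positivity) (by nlinarith [sq_nonneg (p.2 : ℝ)])) h
  refine h1.trans ?_
  have h2 : ∑ m ∈ Finset.Icc (-(⌊ρ⌋₊ : ℤ)) ⌊ρ⌋₊, (k * |(m : ℝ)| + k' + 1) * (1 / (1 + (m : ℝ) ^ 2)) =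
      k * (∑ m ∈ Finset.Icc (-(⌊ρ⌋₊ : ℤ)) ⌊ρ⌋₊, |(m : ℝ)| / (1 + (m : ℝ) ^ 2)) +
      (k' + 1) * ∑ m ∈ Finset.Icc (-(⌊ρ⌋₊ : ℤ)) ⌊ρ⌋₊, 1 / (1 + (m : ℝ) ^ 2) := by
    rw [Finset.mul_sum, Finset.mul_sum, ← Finset.sum_add_distrib]
    refine Finset.sum_congr rfl fun m _ => ?_
    ring
  rw [h2]
  have hlog : 1 / 2 ≤ Real.log ρ := by
    have := Real.log_two_gt_d9
    have := Real.log_le_log two_pos hρ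
    linarith
  have hfl : Real.log ⌊ρ⌋₊ ≤ Real.log ρ := by
    have : 2 ≤ ⌊ρ⌋₊ := Nat.le_floor (by simpa using hρ)
    exact Real.log_le_log (by positivity) (Nat.floor_le (by linarith))
  -- The factor `6` comes from `1 ≤ 2 log ρ`, which turns `2 (1 + log ρ)` into `6 log ρ`.
  have h3 := (sum_Icc_abs_div_le ⌊ρ⌋₊).trans (b := 2 * (1 + Real.log ⌊ρ⌋₊)) (c := 6 * Real.log ρ)
    (by linarith)
  have h4 := mul_le_mul_of_nonneg_left h3 hk
  have h5 := mul_le_mul_of_nonneg_left (hBs ⌊ρ⌋₊) (show 0 ≤ k' + 1 by positivity)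
  have h6 : 0 ≤ B * (k * Real.log ρ) := by positivity
  nlinarith

lemma exists_sum_weight_le_of_columns : ∃ B : ℝ, 0 < B ∧ ∀ ρ : ℝ, 2 ≤ ρ → ∀ k k' : ℝ, 0 ≤ k →
    0 ≤ k' → ∀ S ⊆ disc ρ,
      (∀ p ∈ S, ∀ q ∈ S, p.2 = q.2 → (q.1 : ℝ) - p.1 ≤ k * |(p.2 : ℝ)| + k') →
      ∑ p ∈ S, weight p ≤ B * (k * Real.log ρ + k' + 1) := by
  obtain ⟨B, hB, h⟩ := exists_sum_weight_le_of_rows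
  refine ⟨B, hB, fun ρ hρ k k' hk hk' S hS hSr => ?_⟩
  have h1 := h ρ hρ k k' hk hk' (S.map (Equiv.prodComm ℤ ℤ).toEmbedding) (fun p hp => ?_) ?_
  · rw [Finset.sum_map] at h1
    refine le_trans (le_of_eq (Finset.sum_congr rfl fun p _ => ?_)) h1
    exact (weight_swap p).symm
  · obtain ⟨q, hq, rfl⟩ := Finset.mem_map.1 hp
    have := mem_disc.1 (hS hq)
    rw [← latticeNorm_swap] at this
    exact mem_disc.2 this
  · intro p hp q hq hpq
    obtain ⟨p', hp', rfl⟩ := Finset.mem_map.1 hp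
    obtain ⟨q', hq', rfl⟩ := Finset.mem_map.1 hq
    exact hSr p' hp' q' hq' hpq

/-- The diagonals cut the disc into two double sectors whose rows, respectively columns, over `m`
have length at most `2 |m|`. -/
lemma exists_sum_disc_weight_le : ∃ B : ℝ, 0 < B ∧ ∀ ρ : ℝ, 2 ≤ ρ →
    ∑ p ∈ disc ρ, weight p ≤ B * Real.log ρ := by
  obtain ⟨B, hB, h⟩ := exists_sum_weight_le_of_rows
  obtain ⟨B', hB', h'⟩ := exists_sum_weight_le_of_columns
  refine ⟨4 * B + 4 * B', by positivity, fun ρ hρ => ?_⟩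
  have hlog : 1 / 2 ≤ Real.log ρ := by
    have := Real.log_two_gt_d9
    have := Real.log_le_log two_pos hρ
    linarith
  have h1 := h ρ hρ 2 0 (by norm_num) le_rfl ((disc ρ).filter fun p => |(p.2 : ℝ)| ≤ |(p.1 : ℝ)|)
    (Finset.filter_subset _ _) (fun p hp q hq hpq => by
      have hp := (Finset.mem_filter.1 hp).2
      have hq := (Finset.mem_filter.1 hq).2
      rw [← hpq] at hq
      linarith [neg_abs_le (p.2 : ℝ), le_abs_self (q.2 : ℝ)])
  have h2 := h' ρ hρ 2 0 (by norm_num) le_rfl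
    ((disc ρ).filter fun p => ¬ |(p.2 : ℝ)| ≤ |(p.1 : ℝ)|)
    (Finset.filter_subset _ _) (fun p hp q hq hpq => by
      have hp := (Finset.mem_filter.1 hp).2
      have hq := (Finset.mem_filter.1 hq).2
      rw [← hpq] at hq
      push Not at hp hq
      linarith [neg_abs_le (p.1 : ℝ), le_abs_self (q.1 : ℝ)])
  rw [← Finset.sum_filter_add_sum_filter_not _ fun p : ℤ × ℤ => |(p.2 : ℝ)| ≤ |(p.1 : ℝ)|]
  nlinarith

/-- The triangle of points `(m + 1, n)` with `n ≤ m < M` suffices: each row contributes at least `1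
/ (3 (m + 1))`, and these add up to a harmonic sum. -/
lemma exists_le_sum_disc_weight : ∃ b : ℝ, 0 < b ∧ ∀ ρ : ℝ, 4 ≤ ρ →
    b * Real.log ρ ≤ ∑ p ∈ disc ρ, weight p := by
  refine ⟨1 / 6, by norm_num, fun ρ hρ => ?_⟩
  set M := ⌊ρ / 2⌋₊ with hM
  have hMρ : (M : ℝ) ≤ ρ / 2 := Nat.floor_le (by positivity)
  have hMρ' : ρ / 2 < M + 1 := Nat.lt_floor_add_one _
  set e : (_ : ℕ) × ℕ → ℤ × ℤ := fun s => ((s.1 : ℤ) + 1, (s.2 : ℤ)) with he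
  have hinj : Function.Injective e := by
    rintro ⟨a, b⟩ ⟨a', b'⟩ h
    simp only [he, Prod.mk.injEq, add_left_inj, Nat.cast_inj] at h
    rw [h.1, h.2]
  have hsub : ((Finset.range M).sigma fun m => Finset.range (m + 1)).image e ⊆ disc ρ := by
    intro p hp
    obtain ⟨⟨m, n⟩, hs, rfl⟩ := Finset.mem_image.1 hp
    rw [Finset.mem_sigma, Finset.mem_range, Finset.mem_range] at hs
    simp only at hs
    have h1 : (m : ℝ) + 1 ≤ M := by exact_mod_cast hs.1
    have h2 : (n : ℝ) ≤ M := by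
      have : n ≤ M := by omega
      exact_mod_cast this
    refine mem_disc.2 ((latticeNorm_le_add _).trans ?_)
    simp only [he, Int.cast_add, Int.cast_natCast, Int.cast_one]
    rw [abs_of_nonneg (by positivity), abs_of_nonneg (by positivity)]
    linarith
  have h1 := Finset.sum_le_sum_of_subset_of_nonneg hsub fun p _ _ => (weight_pos p).le
  rw [Finset.sum_image hinj.injOn, Finset.sum_sigma] at h1
  refine le_trans ?_ h1
  have h2 : ∀ m ∈ Finset.range M, 1 / 3 * ((m : ℝ) + 1)⁻¹ ≤
      ∑ n ∈ Finset.range (m + 1), weight (e ⟨m, n⟩) := by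
    intro m _
    have h3 : ∀ n ∈ Finset.range (m + 1), 1 / (3 * ((m : ℝ) + 1) ^ 2) ≤ weight (e ⟨m, n⟩) := by
      intro n hn
      have : (n : ℝ) ≤ m := by
        have := Finset.mem_range.1 hn
        exact_mod_cast (by omega : n ≤ m)
      simp only [weight, he, Int.cast_add, Int.cast_natCast, Int.cast_one]
      refine one_div_le_one_div_of_le (by positivity) ?_
      nlinarith [Nat.cast_nonneg (α := ℝ) n, Nat.cast_nonneg (α := ℝ) m]
    refine le_trans (le_of_eq ?_) (Finset.card_nsmul_le_sum _ _ _ h3)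
    rw [Finset.card_range, nsmul_eq_mul]
    push_cast
    field_simp
  refine le_trans ?_ (Finset.sum_le_sum h2)
  rw [← Finset.mul_sum]
  have h4 := log_add_one_le_harmonic M
  rw [harmonic] at h4
  push_cast at h4
  have h5 : Real.log ρ / 2 ≤ Real.log (M + 1) := by
    have h6 : Real.log (ρ / 2) ≤ Real.log (M + 1) := Real.log_le_log (by positivity) hMρ'.le
    rw [Real.log_div (by positivity) two_ne_zero] at h6
    have h7 : 2 * Real.log 2 ≤ Real.log ρ := by
      rw [← Real.log_rpow two_pos]
      exact Real.log_le_log (by positivity) (by norm_num; linarith)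
    linarith
  linarith

lemma card_disc_le {ρ : ℝ} (hρ : 0 ≤ ρ) : ((disc ρ).card : ℝ) ≤ (2 * ρ + 1) ^ 2 := by
  have h := sum_le_sum_rows (S := disc ρ) subset_rfl (L := fun _ => 2 * ρ) (g := fun _ => 1)
    (F := fun _ => 1) (fun _ => by positivity) (fun _ => by positivity) (fun _ _ => le_rfl)
    (fun p hp q hq _ => by
      have h1 := (abs_snd_le_latticeNorm p).trans (mem_disc.1 hp)
      have h2 := (abs_snd_le_latticeNorm q).trans (mem_disc.1 hq)
      linarith [neg_abs_le (p.2 : ℝ), le_abs_self (q.2 : ℝ)])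
  simp only [Finset.sum_const, nsmul_eq_mul, mul_one, Int.card_Icc] at h
  refine h.trans ?_
  have h1 : (((⌊ρ⌋₊ : ℤ) + 1 - -(⌊ρ⌋₊ : ℤ)).toNat : ℝ) ≤ 2 * ρ + 1 := by
    have e : ((⌊ρ⌋₊ : ℤ) + 1 - -(⌊ρ⌋₊ : ℤ)).toNat = 2 * ⌊ρ⌋₊ + 1 := by omega
    rw [e]
    push_cast
    linarith [Nat.floor_le hρ]
  calc _ ≤ (2 * ρ + 1) * (2 * ρ + 1) := by gcongr
    _ = _ := by ring

end Lattice

/-! ### Total interaction of the phases in a disc -/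

section PairSums

/-- Within one row of the shell the squares of the second coordinates differ by at most `2 ε r²`. On
points where that coordinate has one sign, `(q - p)² ≤ |q² - p²|`, so a row has at most `2 √ε r + 1`
points; there are at most `2 r + 1` rows and two signs. -/
lemma card_shell_le {r ε : ℝ} (hr : 1 ≤ r) (hε : 0 ≤ ε) (hε1 : ε ≤ 1) :
    (((disc r).filter fun p => (1 - ε) * r < latticeNorm p).card : ℝ) ≤
      6 * r * (2 * √ε * r + 1) := by
  have hr0 : 0 < r := by linarith
  set S := (disc r).filter fun p => (1 - ε) * r < latticeNorm p with hS
  set L := 2 * √ε * r with hLdef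
  have hL0 : 0 ≤ L := by positivity
  have hLsq : 2 * ε * r ^ 2 ≤ L ^ 2 := by
    rw [hLdef, mul_pow, mul_pow, Real.sq_sqrt hε]
    nlinarith [mul_nonneg hε (sq_nonneg r)]
  have hkey : ∀ p ∈ S, ∀ q ∈ S, p.1 = q.1 → (q.2 : ℝ) ^ 2 - (p.2 : ℝ) ^ 2 ≤ L ^ 2 := by
    intro p hp q hq hpq
    have hp2 := (Finset.mem_filter.1 hp).2
    have hq1 := mem_disc.1 (Finset.mem_filter.1 hq).1
    have h1 := pow_le_pow_left₀ (latticeNorm_nonneg q) hq1 2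
    have h2 := pow_le_pow_left₀ (by nlinarith) hp2.le 2
    rw [latticeNorm_sq] at h1 h2
    rw [hpq] at h2
    nlinarith [mul_nonneg hε (sq_nonneg r), sq_nonneg ε, sq_nonneg (ε * r)]
  have hhalf : ∀ S' ⊆ S, (∀ p ∈ S', ∀ q ∈ S', p.1 = q.1 → 0 ≤ (p.2 : ℝ) * q.2) →
      (S'.card : ℝ) ≤ (2 * r + 1) * (L + 1) := by
    intro S' hS' hsign
    have h := sum_le_sum_rows (S := S') (ρ := r) (hS'.trans (Finset.filter_subset _ _))
      (L := fun _ => L) (g := fun _ => 1) (F := fun _ => 1) (fun _ => hL0)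
      (fun _ => by positivity) (fun _ _ => le_rfl) (fun p hp q hq hpq => by
        have h1 := hkey p (hS' hp) q (hS' hq) hpq
        have h2 := hkey q (hS' hq) p (hS' hp) hpq.symm
        have h3 := hsign p hp q hq hpq
        have h4 : ((q.2 : ℝ) - p.2) ^ 2 ≤ L ^ 2 := by
          rcases le_total ((p.2 : ℝ) ^ 2) ((q.2 : ℝ) ^ 2) with h | h
          · have : (p.2 : ℝ) ^ 2 ≤ p.2 * q.2 := by
              rw [← abs_of_nonneg h3, abs_mul, ← sq_abs (p.2 : ℝ), sq]
              exact mul_le_mul_of_nonneg_left (sq_le_sq.1 h) (abs_nonneg _)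
            nlinarith
          · have : (q.2 : ℝ) ^ 2 ≤ p.2 * q.2 := by
              rw [← abs_of_nonneg h3, abs_mul, ← sq_abs (q.2 : ℝ), sq]
              exact mul_le_mul_of_nonneg_right (sq_le_sq.1 h) (abs_nonneg _)
            nlinarith
        exact (le_abs_self _).trans (abs_le_of_sq_le_sq h4 hL0))
    simp only [Finset.sum_const, nsmul_eq_mul, mul_one, Int.card_Icc] at h
    refine h.trans ?_
    have h1 : (((⌊r⌋₊ : ℤ) + 1 - -(⌊r⌋₊ : ℤ)).toNat : ℝ) ≤ 2 * r + 1 := by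
      have e : ((⌊r⌋₊ : ℤ) + 1 - -(⌊r⌋₊ : ℤ)).toNat = 2 * ⌊r⌋₊ + 1 := by omega
      rw [e]
      push_cast
      linarith [Nat.floor_le hr0.le]
    gcongr
  have h1 := hhalf (S.filter fun p => 0 ≤ (p.2 : ℝ)) (Finset.filter_subset _ _)
    fun p hp q hq _ => mul_nonneg (Finset.mem_filter.1 hp).2 (Finset.mem_filter.1 hq).2
  have h2 := hhalf (S.filter fun p => ¬ 0 ≤ (p.2 : ℝ)) (Finset.filter_subset _ _)
    fun p hp q hq _ => mul_nonneg_of_nonpos_of_nonpos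
      (not_le.1 (Finset.mem_filter.1 hp).2).le (not_le.1 (Finset.mem_filter.1 hq).2).le
  have h3 := Finset.card_filter_add_card_filter_not (s := S) fun p => 0 ≤ (p.2 : ℝ)
  have h4 : (S.card : ℝ) = ((S.filter fun p => 0 ≤ (p.2 : ℝ)).card : ℝ) +
      ((S.filter fun p => ¬ 0 ≤ (p.2 : ℝ)).card : ℝ) := by exact_mod_cast h3.symm
  rw [h4]
  nlinarith

/-- The correlation of two random phases with standard deviations `s` and `t` is at most this. -/
def gaussianGap (s t : ℝ) : ℝ := Real.exp (-(s - t) ^ 2 / 2)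

lemma gaussianGap_nonneg (s t : ℝ) : 0 ≤ gaussianGap s t := (Real.exp_pos _).le

lemma gaussianGap_le_one (s t : ℝ) : gaussianGap s t ≤ 1 := by
  rw [gaussianGap, Real.exp_le_one_iff]
  have := sq_nonneg (s - t)
  linarith

lemma gaussianGap_comm (s t : ℝ) : gaussianGap s t = gaussianGap t s := by
  rw [gaussianGap, gaussianGap, sub_sq_comm]

/-- The interactions of the lattice point `k` with the points that are not further from the
origin. -/
def innerSum (τ : ℤ × ℤ → ℝ) (k : ℤ × ℤ) : ℝ :=
  ∑ j ∈ disc (latticeNorm k), weight j * gaussianGap (τ j) (τ k)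

/-- The total interaction of the lattice points in a disc. -/
def pairSum (τ : ℤ × ℤ → ℝ) (ρ : ℝ) : ℝ :=
  ∑ j ∈ disc ρ, ∑ k ∈ disc ρ, weight j * weight k * gaussianGap (τ j) (τ k)

lemma innerSum_nonneg (τ : ℤ × ℤ → ℝ) (k : ℤ × ℤ) : 0 ≤ innerSum τ k :=
  Finset.sum_nonneg fun j _ => mul_nonneg (weight_pos j).le (gaussianGap_nonneg _ _)

lemma innerSum_le_sum_weight (τ : ℤ × ℤ → ℝ) {k : ℤ × ℤ} {ρ : ℝ} (hk : k ∈ disc ρ) :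
    innerSum τ k ≤ ∑ p ∈ disc ρ, weight p := by
  refine (Finset.sum_le_sum fun j _ => mul_le_of_le_one_right (weight_pos j).le
    (gaussianGap_le_one _ _)).trans ?_
  exact Finset.sum_le_sum_of_subset_of_nonneg (disc_mono (mem_disc.1 hk))
    fun p _ _ => (weight_pos p).le

/-- The interaction is symmetric, so each pair is charged to its point further from the origin. -/
lemma pairSum_le (τ : ℤ × ℤ → ℝ) (ρ : ℝ) :
    pairSum τ ρ ≤ 2 * ∑ k ∈ disc ρ, weight k * innerSum τ k := by
  set F : ℤ × ℤ → ℤ × ℤ → ℝ := fun j k => weight j * weight k * gaussianGap (τ j) (τ k) with hF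
  have hF0 : ∀ j k, 0 ≤ F j k := fun j k =>
    mul_nonneg (mul_nonneg (weight_pos j).le (weight_pos k).le) (gaussianGap_nonneg _ _)
  have hsymm : ∀ j k, F j k = F k j := fun j k => by
    simp only [hF, gaussianGap_comm (τ j), mul_comm (weight j)]
  have hhalf : ∑ k ∈ disc ρ, ∑ j ∈ disc ρ, (if latticeNorm j ≤ latticeNorm k then F j k else 0) ≤
      ∑ k ∈ disc ρ, weight k * innerSum τ k := by
    refine Finset.sum_le_sum fun k _ => ?_
    rw [← Finset.sum_filter, innerSum, Finset.mul_sum]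
    refine (Finset.sum_le_sum_of_subset_of_nonneg (t := disc (latticeNorm k)) (fun j hj => ?_)
      fun j _ _ => hF0 j k).trans (le_of_eq (Finset.sum_congr rfl fun j _ => ?_))
    · exact mem_disc.2 (Finset.mem_filter.1 hj).2
    · simp only [hF]; ring
  have hle : ∀ j k, F j k ≤ (if latticeNorm j ≤ latticeNorm k then F j k else 0) +
      (if latticeNorm k ≤ latticeNorm j then F k j else 0) := by
    intro j k
    rcases le_total (latticeNorm j) (latticeNorm k) with h | h
    · rw [if_pos h]
      have := hF0 k j
      split_ifs <;> linarith
    · rw [if_pos h, hsymm j k]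
      have := hF0 k j
      split_ifs <;> linarith
  calc pairSum τ ρ ≤ ∑ j ∈ disc ρ, ∑ k ∈ disc ρ,
        ((if latticeNorm j ≤ latticeNorm k then F j k else 0) +
        (if latticeNorm k ≤ latticeNorm j then F k j else 0)) :=
        Finset.sum_le_sum fun j _ => Finset.sum_le_sum fun k _ => hle j k
    _ = (∑ k ∈ disc ρ, ∑ j ∈ disc ρ, (if latticeNorm j ≤ latticeNorm k then F j k else 0)) +
        ∑ k ∈ disc ρ, ∑ j ∈ disc ρ, (if latticeNorm j ≤ latticeNorm k then F j k else 0) := by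
        simp_rw [Finset.sum_add_distrib]
        congr 1
        exact Finset.sum_comm
    _ ≤ _ := by linarith

/-- The difference of squares is at least `b r / 2` and `(s + t)²` is at most `8 A r`, so `s - t` is
at least of order `√r` and its square is linear in `r`. -/
lemma exists_gap {A b C : ℝ} (hA : 0 < A) (hb : 0 < b) (hC : 0 ≤ C) :
    ∃ c > 0, ∃ K : ℝ, ∀ r s t : ℝ, K ≤ r → 0 ≤ s → 0 ≤ t → s ^ 2 ≤ A * r + C →
      t ^ 2 ≤ s ^ 2 - b * r + C → gaussianGap t s ≤ Real.exp (-(c * r)) := by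
  refine ⟨b ^ 2 / (64 * A), by positivity, 2 * C / b + C / A, fun r s t hr hs ht h1 h2 => ?_⟩
  have hr1 : 2 * C ≤ b * r := by
    have : 2 * C / b ≤ r := by linarith [show 0 ≤ C / A by positivity]
    rw [div_le_iff₀ hb] at this
    linarith
  have hr2 : C ≤ A * r := by
    have : C / A ≤ r := by linarith [show 0 ≤ 2 * C / b by positivity]
    rw [div_le_iff₀ hA] at this
    linarith
  have hr0 : 0 ≤ r := le_trans (by positivity) hr
  have h3 : b * r / 2 ≤ (s - t) * (s + t) := by nlinarith
  have hts : t ≤ s := by nlinarith [mul_nonneg hb.le hr0]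
  have h4 : (b * r / 2) ^ 2 ≤ (s - t) ^ 2 * (8 * (A * r)) := by
    have h5 : (s + t) ^ 2 ≤ 8 * (A * r) := by nlinarith
    calc (b * r / 2) ^ 2 ≤ ((s - t) * (s + t)) ^ 2 := pow_le_pow_left₀ (by positivity) h3 2
      _ = (s - t) ^ 2 * (s + t) ^ 2 := by ring
      _ ≤ _ := by gcongr
  rw [gaussianGap, Real.exp_le_exp, neg_div, neg_le_neg_iff]
  rcases hr0.eq_or_lt with h | h
  · rw [← h]; have := sq_nonneg (t - s); linarith
  · have h6 : b ^ 2 * r / (32 * A) ≤ (s - t) ^ 2 := by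
      rw [div_le_iff₀ (by positivity)]
      have : (b ^ 2 * r) * r ≤ ((s - t) ^ 2 * (32 * A)) * r := by nlinarith
      exact le_of_mul_le_mul_right this h
    have h7 : b ^ 2 / (64 * A) * r = b ^ 2 * r / (32 * A) / 2 := by field_simp; norm_num
    rw [h7]
    nlinarith

/-- The part of the interaction that is due to points at a distance is negligible. -/
lemma exists_sum_far_le {A b C η : ℝ} (hA : 0 < A) (hb : 0 < b) (hC : 0 ≤ C) (hη : 0 < η) :
    ∃ K : ℝ, ∀ τ : ℤ × ℤ → ℝ, (∀ p, 0 ≤ τ p) → ∀ k, K ≤ latticeNorm k →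
      τ k ^ 2 ≤ A * latticeNorm k + C → ∀ S ⊆ disc (latticeNorm k),
      (∀ j ∈ S, τ j ^ 2 ≤ τ k ^ 2 - b * latticeNorm k + C) →
      ∑ j ∈ S, weight j * gaussianGap (τ j) (τ k) ≤ η := by
  obtain ⟨c, hc, K, hK⟩ := exists_gap hA hb hC
  -- A disc holds only quadratically many points, which the exponentially small interaction
  -- outweighs.
  have hlim : Tendsto (fun r : ℝ => (2 * r + 1) ^ 2 * Real.exp (-(c * r))) atTop (𝓝 0) := by
    have h : ∀ n : ℕ, Tendsto (fun r : ℝ => r ^ n * Real.exp (-(c * r))) atTop (𝓝 0) := fun n => by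
      simpa using tendsto_rpow_mul_exp_neg_mul_atTop_nhds_zero n c hc
    have h2 := (((h 2).const_mul 4).add ((h 1).const_mul 4)).add (h 0)
    simp only [mul_zero, add_zero] at h2
    refine h2.congr fun r => ?_
    ring
  obtain ⟨K', hK'⟩ := eventually_atTop.1 (hlim.eventually (gt_mem_nhds hη))
  refine ⟨max K K', fun τ hτ k hk hτk S hS hSτ => ?_⟩
  calc ∑ j ∈ S, weight j * gaussianGap (τ j) (τ k) ≤
        ∑ j ∈ S, Real.exp (-(c * latticeNorm k)) := by
        refine Finset.sum_le_sum fun j hj => ?_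
        have h1 := hK _ _ _ ((le_max_left _ _).trans hk) (hτ k) (hτ j) hτk (hSτ j hj)
        have h2 := mul_le_mul (weight_le_one j) h1 (gaussianGap_nonneg _ _) zero_le_one
        rwa [one_mul] at h2
    _ = S.card * Real.exp (-(c * latticeNorm k)) := by rw [Finset.sum_const, nsmul_eq_mul]
    _ ≤ (2 * latticeNorm k + 1) ^ 2 * Real.exp (-(c * latticeNorm k)) := by
        refine mul_le_mul_of_nonneg_right ?_ (Real.exp_pos _).le
        refine le_trans ?_ (card_disc_le (latticeNorm_nonneg k))
        exact_mod_cast Finset.card_le_card hS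
    _ ≤ η := (hK' _ ((le_max_right _ _).trans hk)).le

lemma sum_weight_mul_gap_le {τ : ℤ × ℤ → ℝ} {k : ℤ × ℤ} {S : Finset (ℤ × ℤ)} {r N : ℝ}
    (hr : 0 < r) (hN : (S.card : ℝ) ≤ N) (hS : ∀ j ∈ S, r ≤ latticeNorm j) :
    ∑ j ∈ S, weight j * gaussianGap (τ j) (τ k) ≤ N / r ^ 2 := by
  calc ∑ j ∈ S, weight j * gaussianGap (τ j) (τ k) ≤ ∑ j ∈ S, 1 / r ^ 2 :=
        Finset.sum_le_sum fun j hj => (mul_le_of_le_one_right (weight_pos j).le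
          (gaussianGap_le_one _ _)).trans (weight_le_of_le hr (hS j hj))
    _ = S.card * (1 / r ^ 2) := by rw [Finset.sum_const, nsmul_eq_mul]
    _ ≤ N * (1 / r ^ 2) := by gcongr
    _ = N / r ^ 2 := by ring

/-- If the phases have variances asymptotically proportional to the distance, then each point
interacts weakly with the others. -/
lemma exists_innerSum_le_of_linear {τ : ℤ × ℤ → ℝ} {A C : ℝ} (hA : 0 < A) (hτ : ∀ p, 0 ≤ τ p)
    (hτA : ∀ p, |τ p ^ 2 - A * latticeNorm p| ≤ C) {η : ℝ} (hη : 0 < η) :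
    ∃ K : ℝ, ∀ k, K ≤ latticeNorm k → innerSum τ k ≤ η := by
  have hC : 0 ≤ C := (abs_nonneg _).trans (hτA 0)
  -- The shell of relative width `δ²` has about `12 δ r²` points of weight at most `4 / r²`, which
  -- contribute `48 δ ≤ η / 3` and a remainder `24 / r`. Inside the shell the variances fall short
  -- of that at `k` by a multiple of `δ² r`, so those points are far in the sense of
  -- `exists_sum_far_le`.
  set δ := min (1 / 2) (η / 144) with hδ
  have hδ0 : 0 < δ := by positivity
  have hδ1 : δ ≤ 1 / 2 := min_le_left _ _
  have hδ2 : δ ≤ η / 144 := min_le_right _ _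
  obtain ⟨K, hK⟩ := exists_sum_far_le (A := A) (b := A * δ ^ 2) (C := 2 * C) (η := η / 3) hA
    (by positivity) (by positivity) (by positivity)
  refine ⟨max K (max 1 (72 / η)), fun k hk => ?_⟩
  have hk1 : 1 ≤ latticeNorm k := (le_max_left _ _).trans ((le_max_right _ _).trans hk)
  have hk2 : 72 / η ≤ latticeNorm k := (le_max_right _ _).trans ((le_max_right _ _).trans hk)
  have hk0 : 0 < latticeNorm k := by linarith
  have hτk := abs_le.1 (hτA k)
  have hδsq : δ ^ 2 ≤ 1 / 2 := by nlinarith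
  rw [innerSum, ← Finset.sum_filter_add_sum_filter_not _ fun j =>
    (1 - δ ^ 2) * latticeNorm k < latticeNorm j]
  have h1 : ∑ j ∈ (disc (latticeNorm k)).filter fun j =>
      (1 - δ ^ 2) * latticeNorm k < latticeNorm j, weight j * gaussianGap (τ j) (τ k) ≤
      6 * latticeNorm k * (2 * √(δ ^ 2) * latticeNorm k + 1) / (latticeNorm k / 2) ^ 2 :=
    sum_weight_mul_gap_le (by positivity) (card_shell_le hk1 (by positivity) (by linarith))
      fun j hj => by
        have := (Finset.mem_filter.1 hj).2
        nlinarith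
  have h2 : ∑ j ∈ (disc (latticeNorm k)).filter fun j =>
      ¬ (1 - δ ^ 2) * latticeNorm k < latticeNorm j, weight j * gaussianGap (τ j) (τ k) ≤ η / 3 := by
    refine hK τ hτ k ((le_max_left _ _).trans hk) (by linarith) _ (Finset.filter_subset _ _)
      fun j hj => ?_
    have hj := not_lt.1 (Finset.mem_filter.1 hj).2
    have hτj := abs_le.1 (hτA j)
    nlinarith [mul_le_mul_of_nonneg_left hj hA.le]
  have h3 : 6 * latticeNorm k * (2 * √(δ ^ 2) * latticeNorm k + 1) / (latticeNorm k / 2) ^ 2 ≤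
      48 * δ + 24 / latticeNorm k := by
    rw [Real.sqrt_sq hδ0.le]
    apply le_of_eq
    field_simp
    ring
  have h4 : 24 / latticeNorm k ≤ η / 3 := by
    rw [div_le_iff₀ hη] at hk2
    rw [div_le_div_iff₀ hk0 (by norm_num)]
    linarith
  linarith

/-- If the phases have variances asymptotically proportional to the distance, then the total
interaction in a disc is of smaller order than the logarithm of the radius. -/
theorem pairSum_le_of_linear {τ : ℤ × ℤ → ℝ} {A C : ℝ} (hA : 0 < A) (hτ : ∀ p, 0 ≤ τ p)
    (hτA : ∀ p, |τ p ^ 2 - A * latticeNorm p| ≤ C) {η : ℝ} (hη : 0 < η) :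
    ∀ᶠ ρ in atTop, pairSum τ ρ ≤ η * Real.log ρ := by
  obtain ⟨B, hB, hW⟩ := exists_sum_disc_weight_le
  obtain ⟨K, hK⟩ := exists_innerSum_le_of_linear hA hτ hτA (η := η / (4 * B)) (by positivity)
  -- The finitely many points near the origin contribute a constant, which `log ρ` eventually
  -- dominates.
  set Q := ∑ k ∈ disc K, innerSum τ k with hQ
  filter_upwards [eventually_ge_atTop 2, Real.tendsto_log_atTop.eventually_ge_atTop (4 * Q / η)]
    with ρ hρ hρQ
  refine (pairSum_le τ ρ).trans ?_
  have h1 : ∑ k ∈ disc ρ, weight k * innerSum τ k ≤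
      ∑ k ∈ disc ρ, (weight k * (η / (4 * B)) + if k ∈ disc K then innerSum τ k else 0) := by
    refine Finset.sum_le_sum fun k _ => ?_
    by_cases hk : k ∈ disc K
    · rw [if_pos hk]
      have := mul_le_of_le_one_left (innerSum_nonneg τ k) (weight_le_one k)
      have := (weight_pos k)
      have : 0 ≤ weight k * (η / (4 * B)) := by positivity
      linarith
    · rw [if_neg hk, add_zero]
      exact mul_le_mul_of_nonneg_left (hK k (not_le.1 (mt mem_disc.2 hk)).le) (weight_pos k).le
  have h2 : ∑ k ∈ disc ρ, (if k ∈ disc K then innerSum τ k else 0) ≤ Q := by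
    rw [← Finset.sum_filter]
    exact Finset.sum_le_sum_of_subset_of_nonneg (fun k hk => (Finset.mem_filter.1 hk).2)
      fun k _ _ => innerSum_nonneg τ k
  rw [Finset.sum_add_distrib, ← Finset.sum_mul] at h1
  have h3 : (∑ k ∈ disc ρ, weight k) * (η / (4 * B)) ≤ η / 4 * Real.log ρ := by
    calc (∑ k ∈ disc ρ, weight k) * (η / (4 * B)) ≤ (B * Real.log ρ) * (η / (4 * B)) := by
          gcongr
          exact hW ρ hρ
      _ = _ := by field_simp
  rw [div_le_iff₀ hη] at hρQ
  linarith

/-- If the variances of the phases grow at most linearly, and at least linearly outside sets of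
small logarithmic density, then the total interaction in a disc is of smaller order than the
squared logarithm of the radius. -/
theorem pairSum_le_of_sparse {τ : ℤ × ℤ → ℝ} {A C : ℝ} (hA : 0 < A) (hτ : ∀ p, 0 ≤ τ p)
    (hτA : ∀ p, τ p ^ 2 ≤ A * latticeNorm p + C)
    (hbad : ∀ δ > 0, ∃ (Z : Set (ℤ × ℤ)) (b K : ℝ), 0 < b ∧
      (∀ p ∉ Z, b * latticeNorm p - K ≤ τ p ^ 2) ∧
      ∀ ρ, 2 ≤ ρ → ∀ S ⊆ disc ρ, (∀ p ∈ S, p ∈ Z) →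
        ∑ p ∈ S, weight p ≤ δ * Real.log ρ + K)
    {η : ℝ} (hη : 0 < η) :
    ∀ᶠ ρ in atTop, pairSum τ ρ ≤ η * Real.log ρ ^ 2 := by
  classical
  obtain ⟨B, hB, hW⟩ := exists_sum_disc_weight_le
  obtain ⟨Z, b, K, hb, hZ, hZS⟩ := hbad (η / (4 * B)) (by positivity)
  set b' := min b A with hb'
  have hb'0 : 0 < b' := lt_min hb hA
  -- Chosen so that points `j` with `|j| ≤ θ |k|` have variance at most `b' |k| / 2 + C`, about half
  -- the lower bound for the variance at a good `k`.
  set θ := b' / (2 * A) with hθ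
  have hθ0 : 0 < θ := by positivity
  obtain ⟨K₁, hK₁⟩ := exists_sum_far_le (A := A) (b := b' / 2) (C := |C| + |K|) (η := 1) hA
    (by positivity) (by positivity) one_pos
  set r := max K₁ 1 with hr
  set Q := (2 * r + 1) ^ 2 + (1 + 9 / θ ^ 2) with hQ
  have hr1 : 1 ≤ r := le_max_right _ _
  -- The points with `|j| > θ |k|` have bounded total weight, and the closer ones interact
  -- negligibly. A good point thus contributes `O(1)`, while a bad one may contribute the full `B
  -- log ρ`, compensated by the small weight of `Z`.
  have hgood : ∀ k ∉ Z, innerSum τ k ≤ Q := by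
    intro k hk
    have hnk := latticeNorm_nonneg k
    by_cases hkr : latticeNorm k ≤ r
    · have h1 : innerSum τ k ≤ (disc r).card := by
        refine (innerSum_le_sum_weight τ (mem_disc.2 hkr)).trans ?_
        refine (Finset.sum_le_sum fun p _ => weight_le_one p).trans ?_
        simp
      have h2 := card_disc_le (ρ := r) (by linarith)
      have : 0 ≤ 9 / θ ^ 2 := by positivity
      rw [hQ]
      linarith
    · push Not at hkr
      have hk0 : 0 < latticeNorm k := by linarith
      rw [innerSum, ← Finset.sum_filter_add_sum_filter_not _ fun j =>
        θ * latticeNorm k < latticeNorm j]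
      have h1 : ∑ j ∈ (disc (latticeNorm k)).filter fun j =>
          θ * latticeNorm k < latticeNorm j, weight j * gaussianGap (τ j) (τ k) ≤
          (2 * latticeNorm k + 1) ^ 2 / (θ * latticeNorm k) ^ 2 := by
        refine sum_weight_mul_gap_le (by positivity) ?_ fun j hj => (Finset.mem_filter.1 hj).2.le
        refine le_trans ?_ (card_disc_le hnk)
        exact_mod_cast Finset.card_le_card (Finset.filter_subset _ _)
      have h2 : (2 * latticeNorm k + 1) ^ 2 / (θ * latticeNorm k) ^ 2 ≤ 9 / θ ^ 2 := by
        rw [div_le_div_iff₀ (by positivity) (by positivity)]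
        have h3 : (2 * latticeNorm k + 1) ^ 2 ≤ 9 * latticeNorm k ^ 2 := by nlinarith
        calc (2 * latticeNorm k + 1) ^ 2 * θ ^ 2 ≤ 9 * latticeNorm k ^ 2 * θ ^ 2 := by gcongr
          _ = _ := by ring
      have h3 : ∑ j ∈ (disc (latticeNorm k)).filter fun j =>
          ¬ θ * latticeNorm k < latticeNorm j, weight j * gaussianGap (τ j) (τ k) ≤ 1 := by
        refine hK₁ τ hτ k ((le_max_left _ _).trans hkr.le) ?_ _ (Finset.filter_subset _ _)
          fun j hj => ?_
        · linarith [hτA k, le_abs_self C, abs_nonneg K]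
        · have hj := not_lt.1 (Finset.mem_filter.1 hj).2
          have h4 := mul_le_mul_of_nonneg_left hj hA.le
          have h5 : A * (θ * latticeNorm k) = b' / 2 * latticeNorm k := by
            rw [hθ]; field_simp
          have h6 : b' * latticeNorm k ≤ b * latticeNorm k :=
            mul_le_mul_of_nonneg_right (min_le_left _ _) hnk
          linarith [hτA j, hZ k hk, le_abs_self C, le_abs_self K]
      have : 0 ≤ (2 * r + 1) ^ 2 := by positivity
      linarith
  have hQ0 : 0 ≤ Q := by positivity
  filter_upwards [eventually_ge_atTop 2,
    Real.tendsto_log_atTop.eventually_ge_atTop (4 * B * (Q + K) / η)] with ρ hρ hρQ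
  have hlog : 0 ≤ Real.log ρ := Real.log_nonneg (by linarith)
  refine (pairSum_le τ ρ).trans ?_
  have hW' := hW ρ hρ
  have h1 : ∑ k ∈ disc ρ, weight k * innerSum τ k ≤
      ∑ k ∈ disc ρ, (weight k * Q + if k ∈ Z then weight k * (B * Real.log ρ) else 0) := by
    refine Finset.sum_le_sum fun k hk => ?_
    by_cases hkZ : k ∈ Z
    · rw [if_pos hkZ]
      have h2 := mul_le_mul_of_nonneg_left ((innerSum_le_sum_weight τ hk).trans hW')
        (weight_pos k).le
      have := mul_nonneg (weight_pos k).le hQ0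
      linarith
    · rw [if_neg hkZ, add_zero]
      exact mul_le_mul_of_nonneg_left (hgood k hkZ) (weight_pos k).le
  rw [Finset.sum_add_distrib, ← Finset.sum_filter, ← Finset.sum_mul, ← Finset.sum_mul] at h1
  have h2 := hZS ρ hρ ((disc ρ).filter fun k => k ∈ Z) (Finset.filter_subset _ _)
    fun p hp => (Finset.mem_filter.1 hp).2
  have h3 := mul_le_mul_of_nonneg_right h2 (mul_nonneg hB.le hlog)
  have h4 := mul_le_mul_of_nonneg_right hW' hQ0
  rw [div_le_iff₀ hη] at hρQ
  have h5 := mul_le_mul_of_nonneg_right hρQ hlog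
  have h6 : η / (4 * B) * Real.log ρ * (B * Real.log ρ) = η / 4 * Real.log ρ ^ 2 := by
    field_simp
  nlinarith

end PairSums

/-! ### Transducers that see two points at a small angle, and bounds for the Green's function -/

section Sparse

/-- Near the line `p.2 α = p.1 β` the norm of `p` is `O(|p.1| + 1)`, because `α ≠ 0`. The row over
`m` therefore has length `O(ε |m| + 1)`, and `ε` can be chosen to make the coefficient of the
logarithm at most `δ`. -/
lemma exists_sum_weight_le_of_strip {α : ℝ} (hα : α ≠ 0) (β : ℝ) {C δ : ℝ} (hC : 0 ≤ C)
    (hδ : 0 < δ) :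
    ∃ ε > 0, ε ≤ 1 ∧ ∃ K : ℝ, ∀ ρ, 2 ≤ ρ → ∀ S ⊆ disc ρ,
      (∀ p ∈ S, |(p.2 : ℝ) * α - p.1 * β| ≤ ε * latticeNorm p + C) →
      ∑ p ∈ S, weight p ≤ δ * Real.log ρ + K := by
  obtain ⟨B, hB, h⟩ := exists_sum_weight_le_of_rows
  have hα0 : 0 < |α| := abs_pos.2 hα
  set M := 1 + 2 * (|β| + 1) / |α| with hM
  have hM0 : 0 < M := by positivity
  set C' := 2 * C / |α| with hC'
  have hC'0 : 0 ≤ C' := by positivity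
  set ε := min (min 1 (|α| / 2)) (δ * |α| / (2 * M * B)) with hε
  have hε0 : 0 < ε := by positivity
  have hε1 : ε ≤ 1 := (min_le_left _ _).trans (min_le_left _ _)
  have hε2 : ε ≤ |α| / 2 := (min_le_left _ _).trans (min_le_right _ _)
  have hε3 : ε ≤ δ * |α| / (2 * M * B) := min_le_right _ _
  refine ⟨ε, hε0, hε1, B * (2 * (C' + C) / |α| + 1), fun ρ hρ S hS hSs => ?_⟩
  have hlog : 0 ≤ Real.log ρ := Real.log_nonneg (by linarith)
  have hnorm : ∀ p ∈ S, latticeNorm p ≤ M * |(p.1 : ℝ)| + C' := by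
    intro p hp
    have h1 := hSs p hp
    have h2 := latticeNorm_le_add p
    have h3 : |(p.2 : ℝ)| * |α| - |(p.1 : ℝ)| * |β| ≤ |(p.2 : ℝ) * α - p.1 * β| := by
      rw [← abs_mul, ← abs_mul]
      exact abs_sub_abs_le_abs_sub _ _
    have h4 : ε * latticeNorm p ≤ |(p.1 : ℝ)| + |α| / 2 * |(p.2 : ℝ)| := by
      calc ε * latticeNorm p ≤ ε * (|(p.1 : ℝ)| + |(p.2 : ℝ)|) := by gcongr
        _ = ε * |(p.1 : ℝ)| + ε * |(p.2 : ℝ)| := by ring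
        _ ≤ 1 * |(p.1 : ℝ)| + |α| / 2 * |(p.2 : ℝ)| := by gcongr
        _ = _ := by ring
    have h5 : |(p.2 : ℝ)| ≤ 2 * (|β| + 1) / |α| * |(p.1 : ℝ)| + C' := by
      have e : 2 * (|β| + 1) / |α| * |(p.1 : ℝ)| + C' =
          (2 * ((|β| + 1) * |(p.1 : ℝ)|) + 2 * C) / |α| := by rw [hC']; ring
      rw [e, le_div_iff₀ hα0]
      linarith
    rw [hM]
    linarith
  have hrow := h ρ hρ (2 * ε * M / |α|) (2 * (C' + C) / |α|) (by positivity) (by positivity) S hS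
    fun p hp q hq hpq => by
      have h1 := hSs p hp
      have h2 := hSs q hq
      have h3 := hnorm p hp
      have h4 := hnorm q hq
      rw [← hpq] at h2 h4
      have h5 : |((q.2 : ℝ) - p.2) * α| ≤ 2 * (ε * (M * |(p.1 : ℝ)| + C') + C) := by
        have e : ((q.2 : ℝ) - p.2) * α = ((q.2 : ℝ) * α - p.1 * β) - ((p.2 : ℝ) * α - p.1 * β) := by
          ring
        rw [e]
        refine (abs_sub _ _).trans ?_
        have := mul_le_mul_of_nonneg_left h3 hε0.le
        have := mul_le_mul_of_nonneg_left h4 hε0.le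
        linarith
      rw [abs_mul] at h5
      have e : 2 * ε * M / |α| * |(p.1 : ℝ)| + 2 * (C' + C) / |α| =
        (2 * ε * M * |(p.1 : ℝ)| + 2 * (C' + C)) / |α| := by ring
      rw [e, le_div_iff₀ hα0]
      have h6 : ε * C' ≤ C' := mul_le_of_le_one_left hC'0 hε1
      have h7 := mul_le_mul_of_nonneg_right (le_abs_self ((q.2 : ℝ) - p.2)) hα0.le
      linarith
  have h8 : B * (2 * ε * M / |α|) ≤ δ := by
    rw [le_div_iff₀ (by positivity)] at hε3
    rw [mul_div_assoc', div_le_iff₀ hα0]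
    linarith
  have h9 := mul_le_mul_of_nonneg_right h8 hlog
  linarith

/-- Lattice points in a narrow sector have small logarithmic density. -/
lemma exists_sum_weight_le_of_sector {α β γ : ℝ} (hne : ¬ (α = 0 ∧ β = 0 ∧ γ = 0)) {C δ : ℝ}
    (hC : 0 ≤ C) (hδ : 0 < δ) :
    ∃ ε > 0, ε ≤ 1 ∧ ∃ K : ℝ, ∀ ρ, 2 ≤ ρ → ∀ S ⊆ disc ρ,
      (∀ p ∈ S, |(p.2 : ℝ) * α - p.1 * β| ≤ ε * latticeNorm p + C ∧
        |(p.1 : ℝ) * γ| ≤ ε * latticeNorm p + C ∧ |(p.2 : ℝ) * γ| ≤ ε * latticeNorm p + C) →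
      ∑ p ∈ S, weight p ≤ δ * Real.log ρ + K := by
  by_cases hα : α = 0
  · by_cases hβ : β = 0
    · have hγ : 0 < |γ| := abs_pos.2 fun h => hne ⟨hα, hβ, h⟩
      -- With `ε ≤ |γ| / 4` the two bounds add up to `|γ| |p| ≤ |γ| |p| / 2 + 2 C`, so only points
      -- of norm at most `4 C / |γ|` remain.
      refine ⟨min 1 (|γ| / 4), by positivity, min_le_left _ _, (disc (4 * C / |γ|)).card,
        fun ρ hρ S _ hSs => ?_⟩
      have hsub : S ⊆ disc (4 * C / |γ|) := by
        intro p hp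
        obtain ⟨-, h1, h2⟩ := hSs p hp
        rw [abs_mul] at h1 h2
        have h3 := mul_le_mul_of_nonneg_right (latticeNorm_le_add p) hγ.le
        have h4 := mul_le_mul_of_nonneg_right (min_le_right 1 (|γ| / 4)) (latticeNorm_nonneg p)
        rw [mem_disc, le_div_iff₀ hγ]
        linarith
      have hlog : 0 ≤ Real.log ρ := Real.log_nonneg (by linarith)
      calc ∑ p ∈ S, weight p ≤ ∑ p ∈ S, (1 : ℝ) := Finset.sum_le_sum fun p _ => weight_le_one p
        _ = S.card := by simp
        _ ≤ (disc (4 * C / |γ|)).card := by exact_mod_cast Finset.card_le_card hsub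
        _ ≤ _ := le_add_of_nonneg_left (by positivity)
    · obtain ⟨ε, hε, hε1, K, h⟩ := exists_sum_weight_le_of_strip hβ α hC hδ
      refine ⟨ε, hε, hε1, K, fun ρ hρ S hS hSs => ?_⟩
      have h1 := h ρ hρ (S.map (Equiv.prodComm ℤ ℤ).toEmbedding) (fun p hp => ?_) fun p hp => ?_
      · rw [Finset.sum_map] at h1
        refine le_trans (le_of_eq (Finset.sum_congr rfl fun p _ => ?_)) h1
        exact (weight_swap p).symm
      · obtain ⟨q, hq, rfl⟩ := Finset.mem_map.1 hp
        have := mem_disc.1 (hS hq)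
        rw [← latticeNorm_swap] at this
        exact mem_disc.2 this
      · obtain ⟨q, hq, rfl⟩ := Finset.mem_map.1 hp
        have h2 := (hSs q hq).1
        rw [abs_sub_comm, ← latticeNorm_swap] at h2
        exact h2
  · obtain ⟨ε, hε, hε1, K, h⟩ := exists_sum_weight_le_of_strip hα β hC hδ
    exact ⟨ε, hε, hε1, K, fun ρ hρ S hS hSs => h ρ hρ S hS fun p hp => (hSs p hp).1⟩

/-- Lagrange's identity. -/
lemma gram_eq (v w : Space) :
    ‖v‖ ^ 2 * ‖w‖ ^ 2 - (inner ℝ v w) ^ 2 = (v 0 * w 1 - v 1 * w 0) ^ 2 +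
      (v 0 * w 2 - v 2 * w 0) ^ 2 + (v 1 * w 2 - v 2 * w 1) ^ 2 := by
  rw [EuclideanSpace.norm_sq_eq, EuclideanSpace.norm_sq_eq, PiLp.inner_apply]
  simp only [Fin.sum_univ_three, Real.norm_eq_abs, sq_abs, RCLike.inner_apply, conj_trivial]
  ring

/-- The Gram determinant is the squared product of both lengths and the sine of the angle; the
assumption bounds one length times the sine. -/
lemma gram_le_of_small_angle {x y y' : Space} (hx : x ≠ y) (hx' : x ≠ y') {ε : ℝ}
    (h : ‖x - y‖ * √(1 - (inner ℝ (direction x y) (direction x y')) ^ 2) < ε) :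
    ‖y - x‖ ^ 2 * ‖y' - x‖ ^ 2 - (inner ℝ (y - x) (y' - x)) ^ 2 ≤ (ε * ‖x - y'‖) ^ 2 := by
  have hd : 0 < ‖x - y‖ := norm_pos_iff.2 (sub_ne_zero.2 hx)
  have hd' : 0 < ‖x - y'‖ := norm_pos_iff.2 (sub_ne_zero.2 hx')
  set k := inner ℝ (direction x y) (direction x y') with hk
  have hk1 : k ^ 2 ≤ 1 := by
    have := abs_real_inner_le_norm (direction x y) (direction x y')
    rw [norm_direction hx, norm_direction hx', one_mul] at this
    exact (sq_le_one_iff_abs_le_one k).2 this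
  have e : inner ℝ (y - x) (y' - x) = ‖x - y‖ * ‖x - y'‖ * k := by
    rw [hk, direction, direction, real_inner_smul_left, real_inner_smul_right]
    field_simp
  rw [e, norm_sub_rev y x, norm_sub_rev y' x]
  have h1 := pow_le_pow_left₀ (by positivity) h.le 2
  rw [mul_pow, Real.sq_sqrt (by linarith)] at h1
  have h2 := mul_le_mul_of_nonneg_right h1 (sq_nonneg ‖x - y'‖)
  linarith

lemma transducer_ne {h : ℝ} {y : Space} (hy : 0 < y 2) (p : ℤ × ℤ) : transducer h p ≠ y := by
  intro e
  rw [← e] at hy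
  simp [transducer] at hy

lemma abs_norm_transducer_sub_sub_le {h : ℝ} (hh : 0 < h) (p : ℤ × ℤ) (y : Space) :
    |‖transducer h p - y‖ - h * latticeNorm p| ≤ ‖y‖ := by
  rw [← norm_transducer hh]
  have := abs_norm_sub_norm_le (transducer h p - y) (transducer h p)
  simpa using this

lemma le_norm_transducer_sub {h : ℝ} {y : Space} (hy : 0 < y 2) (p : ℤ × ℤ) :
    y 2 ≤ ‖transducer h p - y‖ := by
  have := PiLp.norm_apply_le (transducer h p - y) 2
  simpa [transducer, abs_of_pos hy] using this

/-- The transducers from which two different points are seen at a very small angle have small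
logarithmic density. -/
lemma exists_sum_weight_le_of_small_angle {h : ℝ} (hh : 0 < h) {y y' : Space} (hy : 0 < y 2)
    (hy' : 0 < y' 2) (hne : y ≠ y') {δ : ℝ} (hδ : 0 < δ) :
    ∃ ε > 0, ∃ K : ℝ, ∀ ρ, 2 ≤ ρ → ∀ S ⊆ disc ρ,
      (∀ p ∈ S, ‖transducer h p - y‖ * √(1 - (inner ℝ (direction (transducer h p) y)
        (direction (transducer h p) y')) ^ 2) < ε) →
      ∑ p ∈ S, weight p ≤ δ * Real.log ρ + K := by
  set w := y' - y with hw
  have hw0 : ¬ (w 0 = 0 ∧ w 1 = 0 ∧ w 2 = 0) := by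
    rintro ⟨h0, h1, h2⟩
    apply hne
    ext i
    have : w i = 0 := by fin_cases i <;> assumption
    simp only [hw, PiLp.sub_apply] at this
    linarith
  set Q := |y 0 * w 1 - y 1 * w 0| + |y 0 * w 2 - y 2 * w 0| + |y 1 * w 2 - y 2 * w 1| with hQ
  obtain ⟨ε, hε, hε1, K, hK⟩ := exists_sum_weight_le_of_sector hw0 (C := (‖y'‖ + Q) / h)
    (by positivity) hδ
  refine ⟨ε, hε, K, fun ρ hρ S hS hSs => hK ρ hρ S hS fun p hp => ?_⟩
  have hg := gram_le_of_small_angle (transducer_ne hy p) (transducer_ne hy' p) (hSs p hp)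
  -- The Gram determinant is `|(y - x) × (y' - x)|² = |y × w - x × w|²` with `x = h (p.1, p.2, 0)`.
  -- Up to the bounded term `y × w`, each component of `x × w` is therefore at most `ε h |p|`, which
  -- is the condition of a sector along the projection of `w` to the array plane.
  rw [gram_eq] at hg
  have hd := (abs_le.1 (abs_norm_transducer_sub_sub_le hh p y')).2
  have hbound : ε * ‖transducer h p - y'‖ ≤ ε * (h * latticeNorm p) + ‖y'‖ := by
    calc ε * ‖transducer h p - y'‖ ≤ ε * (h * latticeNorm p + ‖y'‖) := by
          gcongr; linarith
      _ = ε * (h * latticeNorm p) + ε * ‖y'‖ := by ring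
      _ ≤ ε * (h * latticeNorm p) + 1 * ‖y'‖ := by gcongr
      _ = _ := by ring
  have hmin : ∀ m q z : ℝ, m ^ 2 ≤ (ε * ‖transducer h p - y'‖) ^ 2 → |q| ≤ Q →
      m = q + h * z → |z| ≤ ε * latticeNorm p + (‖y'‖ + Q) / h := by
    intro m q z hm hq e
    have h1 := abs_le_of_sq_le_sq hm (by positivity)
    have h2 : h * |z| ≤ |m| + |q| := by
      have e1 : h * |z| = |h * z| := by rw [abs_mul, abs_of_pos hh]
      rw [e1, show h * z = m - q by linarith]
      exact abs_sub _ _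
    have e2 : ε * latticeNorm p + (‖y'‖ + Q) / h =
        (ε * (h * latticeNorm p) + (‖y'‖ + Q)) / h := by field_simp
    rw [e2, le_div_iff₀ hh]
    have h3 : |m| ≤ ε * ‖transducer h p - y'‖ := h1
    linarith
  have a0 := abs_nonneg (y 0 * w 1 - y 1 * w 0)
  have a1 := abs_nonneg (y 0 * w 2 - y 2 * w 0)
  have a2 := abs_nonneg (y 1 * w 2 - y 2 * w 1)
  have t0 : transducer h p 0 = h * p.1 := by simp [transducer]
  have t1 : transducer h p 1 = h * p.2 := by simp [transducer]
  have t2 : transducer h p 2 = 0 := by simp [transducer]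
  simp only [PiLp.sub_apply, t0, t1, t2] at hg
  have w0 : w 0 = y' 0 - y 0 := rfl
  have w1 : w 1 = y' 1 - y 1 := rfl
  have w2 : w 2 = y' 2 - y 2 := rfl
  refine ⟨hmin _ (y 0 * w 1 - y 1 * w 0) _ (le_trans ?_ hg) (by linarith)
    (show (y 0 - h * p.1) * (y' 1 - h * p.2) - (y 1 - h * p.2) * (y' 0 - h * p.1) = _ by
      rw [w0, w1]; ring), ?_, ?_⟩
  · linarith [sq_nonneg ((y 0 - h * p.1) * (y' 2 - 0) - (y 2 - 0) * (y' 0 - h * p.1)),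
      sq_nonneg ((y 1 - h * p.2) * (y' 2 - 0) - (y 2 - 0) * (y' 1 - h * p.2))]
  · rw [← abs_neg]
    refine hmin ((y 0 - h * p.1) * (y' 2 - 0) - (y 2 - 0) * (y' 0 - h * p.1))
      (y 0 * w 2 - y 2 * w 0) _ (le_trans ?_ hg) (by linarith) (by rw [w0, w2]; ring)
    linarith [sq_nonneg ((y 0 - h * p.1) * (y' 1 - h * p.2) - (y 1 - h * p.2) * (y' 0 - h * p.1)),
      sq_nonneg ((y 1 - h * p.2) * (y' 2 - 0) - (y 2 - 0) * (y' 1 - h * p.2))]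
  · rw [← abs_neg]
    refine hmin ((y 1 - h * p.2) * (y' 2 - 0) - (y 2 - 0) * (y' 1 - h * p.2))
      (y 1 * w 2 - y 2 * w 1) _ (le_trans ?_ hg) (by linarith) (by rw [w1, w2]; ring)
    linarith [sq_nonneg ((y 0 - h * p.1) * (y' 1 - h * p.2) - (y 1 - h * p.2) * (y' 0 - h * p.1)),
      sq_nonneg ((y 0 - h * p.1) * (y' 2 - 0) - (y 2 - 0) * (y' 0 - h * p.1))]

lemma norm_G0 (κ : ℝ) (x y : Space) : ‖G0 κ x y‖ = 1 / (4 * Real.pi * ‖x - y‖) := by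
  rw [G0, norm_div, mul_comm Complex.I, Complex.norm_exp_ofReal_mul_I, Complex.norm_real,
    Real.norm_of_nonneg (by positivity)]

/-- Since `y` lies off the array plane, every transducer keeps distance at least `y 2` from it,
which handles the points near the origin. -/
lemma exists_norm_G0_sq_le (κ : ℝ) {h : ℝ} (hh : 0 < h) {y : Space} (hy : 0 < y 2) :
    ∃ M > 0, ∀ p, ‖G0 κ (transducer h p) y‖ ^ 2 ≤ M * weight p := by
  set K := (1 + ‖y‖ / y 2) / h with hK
  refine ⟨K ^ 2 + 1 / y 2 ^ 2, by positivity, fun p => ?_⟩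
  have hd := le_norm_transducer_sub (h := h) hy p
  have hd0 : 0 < ‖transducer h p - y‖ := hy.trans_le hd
  have h1 := (abs_le.1 (abs_norm_transducer_sub_sub_le hh p y)).1
  have h2 : latticeNorm p ≤ K * ‖transducer h p - y‖ := by
    rw [hK, div_mul_eq_mul_div, le_div_iff₀ hh]
    have : ‖y‖ ≤ ‖y‖ / y 2 * ‖transducer h p - y‖ := by
      rw [div_mul_eq_mul_div, le_div_iff₀ hy]
      gcongr
    linarith
  have h3 := pow_le_pow_left₀ (latticeNorm_nonneg p) h2 2
  rw [latticeNorm_sq, mul_pow] at h3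
  have h4 : 1 ≤ 1 / y 2 ^ 2 * ‖transducer h p - y‖ ^ 2 := by
    rw [div_mul_eq_mul_div, le_div_iff₀ (by positivity), one_mul, one_mul]
    gcongr
  rw [norm_G0, weight, mul_one_div, one_div, inv_pow, ← one_div, div_le_div_iff₀ (by positivity) (by positivity)]
  have h5 : ‖transducer h p - y‖ ^ 2 ≤ (4 * Real.pi * ‖transducer h p - y‖) ^ 2 := by
    apply pow_le_pow_left₀ hd0.le
    have := Real.pi_gt_three
    nlinarith
  have h6 : 0 ≤ K ^ 2 + 1 / y 2 ^ 2 := by positivity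
  have h7 := mul_le_mul_of_nonneg_left h5 h6
  linarith

lemma exists_le_norm_G0_sq (κ : ℝ) {h : ℝ} (hh : 0 < h) {y : Space} (hy : 0 < y 2) :
    ∃ m > 0, ∀ p, m * weight p ≤ ‖G0 κ (transducer h p) y‖ ^ 2 := by
  set K := (4 * Real.pi) ^ 2 * (2 * h ^ 2 + 2 * ‖y‖ ^ 2) with hK
  have hK0 : 0 < K := by positivity
  refine ⟨1 / K, by positivity, fun p => ?_⟩
  have hd0 : 0 < ‖transducer h p - y‖ := hy.trans_le (le_norm_transducer_sub hy p)
  have h1 := (abs_le.1 (abs_norm_transducer_sub_sub_le hh p y)).2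
  have hn := latticeNorm_nonneg p
  have h2 : ‖transducer h p - y‖ ≤ h * latticeNorm p + ‖y‖ := by linarith
  have h3 := pow_le_pow_left₀ hd0.le h2 2
  have h4 : (h * latticeNorm p + ‖y‖) ^ 2 ≤ 2 * h ^ 2 * latticeNorm p ^ 2 + 2 * ‖y‖ ^ 2 := by
    nlinarith [sq_nonneg (h * latticeNorm p - ‖y‖)]
  have h5 : 2 * h ^ 2 * latticeNorm p ^ 2 + 2 * ‖y‖ ^ 2 ≤
      (2 * h ^ 2 + 2 * ‖y‖ ^ 2) * (1 + latticeNorm p ^ 2) := by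
    nlinarith [mul_nonneg (sq_nonneg ‖y‖) (sq_nonneg (latticeNorm p)), sq_nonneg h]
  rw [norm_G0, weight, add_assoc, ← latticeNorm_sq, one_div_mul_one_div, one_div_pow]
  refine one_div_le_one_div_of_le (by positivity) ?_
  rw [mul_pow, hK, mul_assoc]
  gcongr
  linarith

end Sparse

/-! ### Second moments of sums of Gaussian phase factors -/

section SecondMoment

variable {Ω : Type*} [MeasurableSpace Ω] {P : Measure Ω}

/-- The value at one of the Gaussian characteristic function; the mean only contributes a phase. -/
lemma norm_integral_exp_of_hasGaussianLaw {X : Ω → ℝ} (hX : HasGaussianLaw X P) :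
    ‖∫ ω, Complex.exp (Complex.I * (X ω : ℂ)) ∂P‖ = Real.exp (-Var[X; P] / 2) := by
  have h1 : charFun (P.map X) 1 = ∫ ω, Complex.exp (Complex.I * (X ω : ℂ)) ∂P := by
    rw [charFun_apply_real, integral_map hX.aemeasurable (by fun_prop)]
    refine integral_congr_ae (.of_forall fun ω => ?_)
    dsimp only
    congr 1
    push_cast
    ring
  rw [← h1, hX.map_eq_gaussianReal, charFun_gaussianReal, Complex.norm_exp]
  congr 1
  simp [Real.coe_toNNReal _ (variance_nonneg X P)]
  ring

lemma aestronglyMeasurable_exp_mul_I {X : Ω → ℝ} (hX : AEMeasurable X P) :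
    AEStronglyMeasurable (fun ω => Complex.exp (Complex.I * (X ω : ℂ))) P := by
  have : AEMeasurable (fun ω => Complex.exp (Complex.I * (X ω : ℂ))) P := by fun_prop
  exact this.aestronglyMeasurable

lemma norm_exp_I_mul (x : ℝ) : ‖Complex.exp (Complex.I * (x : ℂ))‖ = 1 := by
  rw [mul_comm, Complex.norm_exp_ofReal_mul_I]

lemma tendstoInMeasure_of_tendsto_integral_sq {ι : Type*} {u : Filter ι} {F : ι → Ω → ℂ}
    (hF : ∀ i, MemLp (F i) 2 P) (h : Tendsto (fun i => ∫ ω, ‖F i ω‖ ^ 2 ∂P) u (𝓝 0)) :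
    TendstoInMeasure P F u fun _ => 0 := by
  refine tendstoInMeasure_of_tendsto_eLpNorm two_ne_zero (fun i => (hF i).1)
    aestronglyMeasurable_const ?_
  have h1 : ∀ i, eLpNorm (F i - fun _ => 0) 2 P =
      ENNReal.ofReal ((∫ ω, ‖F i ω‖ ^ 2 ∂P) ^ (2 : ℝ)⁻¹) := by
    intro i
    have e : (F i - fun _ => (0 : ℂ)) = F i := by ext; simp
    rw [e, (hF i).eLpNorm_eq_integral_rpow_norm two_ne_zero ENNReal.ofNat_ne_top]
    simp
  simp_rw [h1]
  rw [← ENNReal.ofReal_zero]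
  refine ENNReal.tendsto_ofReal ?_
  have := h.rpow_const (p := (2 : ℝ)⁻¹) (Or.inr (by norm_num))
  simpa using this

variable [IsProbabilityMeasure P]

lemma memLp_sum_exp {ι : Type*} (s : Finset ι) (a : ι → ℂ) {θ : ι → Ω → ℝ}
    (hθ : ∀ i, AEMeasurable (θ i) P) :
    MemLp (fun ω => ∑ i ∈ s, a i * Complex.exp (Complex.I * (θ i ω : ℂ))) 2 P := by
  refine memLp_finsetSum s fun i _ => ?_
  refine MemLp.of_bound ((aestronglyMeasurable_exp_mul_I (hθ i)).const_mul (a i)) ‖a i‖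
    (.of_forall fun ω => ?_)
  rw [norm_mul, norm_exp_I_mul, mul_one]

lemma integral_norm_sum_exp_sq_le {ι : Type*} (s : Finset ι) (a : ι → ℂ) {θ : ι → Ω → ℝ}
    (hθ : ∀ i, AEMeasurable (θ i) P) {r : ι → ι → ℝ}
    (hr : ∀ i j, ‖∫ ω, Complex.exp (Complex.I * ((θ i ω - θ j ω : ℝ) : ℂ)) ∂P‖ ≤ r i j) :
    ∫ ω, ‖∑ i ∈ s, a i * Complex.exp (Complex.I * (θ i ω : ℂ))‖ ^ 2 ∂P ≤
      ∑ i ∈ s, ∑ j ∈ s, ‖a i‖ * ‖a j‖ * r i j := by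
  have hexp : ∀ ω, ((‖∑ i ∈ s, a i * Complex.exp (Complex.I * (θ i ω : ℂ))‖ ^ 2 : ℝ) : ℂ) =
      ∑ i ∈ s, ∑ j ∈ s, (a i * (starRingEnd ℂ) (a j)) *
        Complex.exp (Complex.I * ((θ i ω - θ j ω : ℝ) : ℂ)) := by
    intro ω
    rw [Complex.ofReal_pow, ← Complex.mul_conj', map_sum, Finset.sum_mul_sum]
    refine Finset.sum_congr rfl fun i _ => Finset.sum_congr rfl fun j _ => ?_
    have h1 : Complex.exp (Complex.I * ((θ i ω - θ j ω : ℝ) : ℂ)) =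
        Complex.exp (Complex.I * (θ i ω : ℂ)) *
          (starRingEnd ℂ) (Complex.exp (Complex.I * (θ j ω : ℂ))) := by
      rw [← Complex.exp_conj, ← Complex.exp_add]
      congr 1
      simp only [map_mul, Complex.conj_I, Complex.conj_ofReal]
      push_cast
      ring
    rw [h1, map_mul]
    ring
  have hXint : ∀ i j, Integrable
      (fun ω => (a i * (starRingEnd ℂ) (a j)) *
        Complex.exp (Complex.I * ((θ i ω - θ j ω : ℝ) : ℂ))) P := by
    intro i j
    refine Integrable.of_bound ((aestronglyMeasurable_exp_mul_I
      ((hθ i).sub (hθ j))).const_mul _) ‖a i * (starRingEnd ℂ) (a j)‖ (.of_forall fun ω => ?_)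
    rw [norm_mul]
    simp only [norm_exp_I_mul, mul_one, le_refl]
  have h0 : ((∫ ω, ‖∑ i ∈ s, a i * Complex.exp (Complex.I * (θ i ω : ℂ))‖ ^ 2 ∂P : ℝ) : ℂ) =
      ∑ i ∈ s, ∑ j ∈ s, (a i * (starRingEnd ℂ) (a j)) *
        ∫ ω, Complex.exp (Complex.I * ((θ i ω - θ j ω : ℝ) : ℂ)) ∂P := by
    rw [← integral_complex_ofReal]
    simp_rw [hexp]
    rw [integral_finsetSum _ fun i _ => integrable_finsetSum _ fun j _ => hXint i j]
    refine Finset.sum_congr rfl fun i _ => ?_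
    rw [integral_finsetSum _ fun j _ => hXint i j]
    refine Finset.sum_congr rfl fun j _ => ?_
    rw [integral_const_mul]
  calc ∫ ω, ‖∑ i ∈ s, a i * Complex.exp (Complex.I * (θ i ω : ℂ))‖ ^ 2 ∂P
      ≤ ‖((∫ ω, ‖∑ i ∈ s, a i * Complex.exp (Complex.I * (θ i ω : ℂ))‖ ^ 2 ∂P : ℝ) : ℂ)‖ := by
        rw [Complex.norm_real]; exact le_abs_self _
    _ ≤ _ := by
        rw [h0]
        refine (norm_sum_le _ _).trans (Finset.sum_le_sum fun i _ => ?_)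
        refine (norm_sum_le _ _).trans (Finset.sum_le_sum fun j _ => ?_)
        rw [norm_mul, norm_mul, RCLike.norm_conj]
        exact mul_le_mul_of_nonneg_left (hr i j) (by positivity)

/-- Subtracting the mean only lowers the second moment, and the second moment itself turns out to be
small enough. -/
lemma complexVariance_le {X : Ω → ℂ} (hX : MemLp X 2 P) :
    complexVariance P X ≤ ∫ ω, ‖X ω‖ ^ 2 ∂P := by
  unfold complexVariance
  set m := ∫ ω, X ω ∂P with hm
  have hXi : Integrable X P := hX.integrable (by norm_num)
  have hsq : Integrable (fun ω => ‖X ω‖ ^ 2) P := hX.integrable_norm_pow two_ne_zero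
  have hin : Integrable (fun ω => inner ℝ m (X ω)) P := hXi.const_inner m
  have e : ∀ ω, ‖X ω - m‖ ^ 2 = ‖X ω‖ ^ 2 - 2 * inner ℝ m (X ω) + ‖m‖ ^ 2 := fun ω => by
    rw [@norm_sub_sq_real, real_inner_comm]
  simp_rw [e]
  have h1 : ∫ ω, (‖X ω‖ ^ 2 - 2 * inner ℝ m (X ω) + ‖m‖ ^ 2) ∂P =
      ∫ ω, ‖X ω‖ ^ 2 ∂P - 2 * ‖m‖ ^ 2 + ‖m‖ ^ 2 := by
    have h2 : Integrable (fun ω => ‖X ω‖ ^ 2 - 2 * inner ℝ m (X ω)) P := hsq.sub (hin.const_mul 2)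
    rw [integral_add h2 (integrable_const _), integral_sub hsq (hin.const_mul 2),
      integral_const_mul, integral_inner hXi, ← hm, real_inner_self_eq_norm_sq]
    simp
  rw [h1]
  linarith [sq_nonneg ‖m‖]

/-- The second moment of a sum of random phase factors is bounded by the total interaction of the
lattice points. -/
lemma integral_norm_sum_exp_sq_le_pairSum {Y : ℤ × ℤ → Ω → ℝ} {ζ : ℤ × ℤ → Lp ℝ 2 P}
    (hζ : ∀ p, ζ p =ᵐ[P] Y p) (hmean : ∀ p, ∫ ω, Y p ω ∂P = 0)
    (hY : IsGaussianProcess Y P) {t B : ℝ} {a : ℤ × ℤ → ℂ}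
    (ha : ∀ p, ‖a p‖ ≤ B * weight p) (ρ : ℝ) :
    ∫ ω, ‖∑ p ∈ disc ρ, a p * Complex.exp (Complex.I * ((t * Y p ω : ℝ) : ℂ))‖ ^ 2 ∂P ≤
      B ^ 2 * pairSum (fun p => t * ‖ζ p‖) ρ := by
  have hXint : ∀ p, Integrable (Y p) P := fun p => (hY.hasGaussianLaw_eval p).integrable
  have hr : ∀ i j, ‖∫ ω, Complex.exp (Complex.I * ((t * Y i ω - t * Y j ω : ℝ) : ℂ)) ∂P‖ ≤
      gaussianGap (t * ‖ζ i‖) (t * ‖ζ j‖) := by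
    intro i j
    have hG : HasGaussianLaw (fun ω => t * Y i ω - t * Y j ω) P := by
      refine ((hY.hasGaussianLaw_sub (s := i) (t := j)).fun_smul t).congr (.of_forall fun ω => ?_)
      simp [mul_sub]
    have hvar : Var[fun ω => t * Y i ω - t * Y j ω; P] = t ^ 2 * ‖ζ i - ζ j‖ ^ 2 := by
      rw [variance_of_integral_eq_zero hG.aemeasurable]
      · rw [← real_inner_self_eq_norm_sq, L2.inner_def, ← integral_const_mul]
        refine integral_congr_ae ?_
        filter_upwards [hζ i, hζ j, Lp.coeFn_sub (ζ i) (ζ j)] with ω h1 h2 h3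
        simp only [h3, Pi.sub_apply, h1, h2, RCLike.inner_apply, conj_trivial]
        ring
      · rw [integral_sub ((hXint i).const_mul t) ((hXint j).const_mul t), integral_const_mul,
          integral_const_mul, hmean, hmean]
        simp
    rw [norm_integral_exp_of_hasGaussianLaw hG, hvar, gaussianGap, Real.exp_le_exp]
    -- Correlations between different transducers are discarded: the distance of two vectors is at
    -- least the difference of their norms.
    have h1 := abs_norm_sub_norm_le (ζ i) (ζ j)
    have h2 := sq_le_sq.2 (h1.trans (le_abs_self _))
    have h3 := mul_le_mul_of_nonneg_left h2 (sq_nonneg t)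
    have h4 : (t * ‖ζ i‖ - t * ‖ζ j‖) ^ 2 = t ^ 2 * (‖ζ i‖ - ‖ζ j‖) ^ 2 := by ring
    rw [h4]
    linarith
  refine (integral_norm_sum_exp_sq_le (disc ρ) a (θ := fun p ω => t * Y p ω)
    (fun p => (hY.aemeasurable p).const_mul t) hr).trans ?_
  rw [pairSum, Finset.mul_sum]
  refine Finset.sum_le_sum fun i _ => ?_
  rw [Finset.mul_sum]
  refine Finset.sum_le_sum fun j _ => ?_
  have h1 := mul_le_mul (ha i) (ha j) (norm_nonneg _) ((norm_nonneg _).trans (ha i))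
  have h2 := mul_le_mul_of_nonneg_right h1 (gaussianGap_nonneg (t * ‖ζ i‖) (t * ‖ζ j‖))
  refine h2.trans_eq ?_
  ring

end SecondMoment

/-! ### The inner products and norms as lattice sums -/

section Array

variable {Ω : Type*} (μ : Space → Ω → ℝ) (κ σ l h a : ℝ)

lemma sum_arrayLabels {E : Type*} [AddCommMonoid E] {h : ℝ} (hh : 0 < h) (a : ℝ)
    (f : ℤ × ℤ → E) :
    ∑ p : arrayLabels h a, f p = ∑ p ∈ disc (a / (2 * h)), f p := by
  rw [Finset.sum_coe_sort (arrayLabels h a) f, arrayLabels_eq_disc hh]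

lemma norm_G (x y : Space) (ω : Ω) : ‖G μ κ σ l x y ω‖ = ‖G0 κ x y‖ := by
  rw [G, norm_mul, norm_exp_I_mul, mul_one]

lemma norm_g (y : Space) (ω : Ω) : ‖g μ κ σ l h a y ω‖ = ‖g0 κ h a y‖ := by
  rw [EuclideanSpace.norm_eq, EuclideanSpace.norm_eq]
  simp only [g, g0, norm_G]

lemma norm_g0_sq {h : ℝ} (hh : 0 < h) (y : Space) :
    ‖g0 κ h a y‖ ^ 2 = ∑ p ∈ disc (a / (2 * h)), ‖G0 κ (transducer h p) y‖ ^ 2 := by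
  rw [EuclideanSpace.norm_sq_eq, ← sum_arrayLabels hh]
  rfl

/-- The products of the homogeneous Green's functions for two points. -/
def amplitude (y₁ y₂ : Space) (p : ℤ × ℤ) : ℂ :=
  G0 κ (transducer h p) y₂ * (starRingEnd ℂ) (G0 κ (transducer h p) y₁)

lemma inner_g0_g {h : ℝ} (hh : 0 < h) (y₁ y₂ : Space) (ω : Ω) :
    inner ℂ (g0 κ h a y₁) (g μ κ σ l h a y₂ ω) = ∑ p ∈ disc (a / (2 * h)),
      amplitude κ h y₁ y₂ p * Complex.exp (Complex.I *
        ((σ * κ * pathIntegral μ l (transducer h p) y₂ ω : ℝ) : ℂ)) := by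
  rw [PiLp.inner_apply, ← sum_arrayLabels hh]
  refine Finset.sum_congr rfl fun p _ => ?_
  simp only [g, g0, G, amplitude, RCLike.inner_apply]
  ring

lemma inner_g_g {h : ℝ} (hh : 0 < h) (y₁ y₂ : Space) (ω : Ω) :
    inner ℂ (g μ κ σ l h a y₁ ω) (g μ κ σ l h a y₂ ω) = ∑ p ∈ disc (a / (2 * h)),
      amplitude κ h y₁ y₂ p * Complex.exp (Complex.I *
        ((σ * κ * (pathIntegral μ l (transducer h p) y₂ ω -
          pathIntegral μ l (transducer h p) y₁ ω) : ℝ) : ℂ)) := by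
  rw [PiLp.inner_apply, ← sum_arrayLabels hh]
  refine Finset.sum_congr rfl fun p _ => ?_
  simp only [g, G, amplitude, RCLike.inner_apply]
  have e : ∀ s t : ℝ, Complex.exp (Complex.I * ((σ * κ * (t - s) : ℝ) : ℂ)) =
      Complex.exp (Complex.I * ((σ * κ * t : ℝ) : ℂ)) *
        (starRingEnd ℂ) (Complex.exp (Complex.I * ((σ * κ * s : ℝ) : ℂ))) := by
    intro s t
    rw [← Complex.exp_conj, ← Complex.exp_add]
    congr 1
    simp only [map_mul, Complex.conj_I, Complex.conj_ofReal]
    push_cast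
    ring
  rw [e, map_mul]
  ring

lemma exists_norm_amplitude_le {h : ℝ} (hh : 0 < h) {y₁ y₂ : Space} (hy₁ : 0 < y₁ 2)
    (hy₂ : 0 < y₂ 2) : ∃ B > 0, ∀ p, ‖amplitude κ h y₁ y₂ p‖ ≤ B * weight p := by
  obtain ⟨M₁, hM₁, h₁⟩ := exists_norm_G0_sq_le κ hh hy₁
  obtain ⟨M₂, hM₂, h₂⟩ := exists_norm_G0_sq_le κ hh hy₂
  refine ⟨M₁ + M₂, by positivity, fun p => ?_⟩
  rw [amplitude, norm_mul, RCLike.norm_conj]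
  nlinarith [h₁ p, h₂ p, sq_nonneg (‖G0 κ (transducer h p) y₁‖ - ‖G0 κ (transducer h p) y₂‖),
    sq_nonneg ‖G0 κ (transducer h p) y₁‖, sq_nonneg ‖G0 κ (transducer h p) y₂‖]

lemma exists_log_le_norm_g0_sq {h : ℝ} (hh : 0 < h) {y : Space} (hy : 0 < y 2) :
    ∃ c > 0, ∀ a, 4 ≤ a / (2 * h) → c * Real.log (a / (2 * h)) ≤ ‖g0 κ h a y‖ ^ 2 := by
  obtain ⟨b, hb, hW⟩ := exists_le_sum_disc_weight
  obtain ⟨m, hm, hG⟩ := exists_le_norm_G0_sq κ hh hy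
  refine ⟨m * b, by positivity, fun a ha => ?_⟩
  rw [norm_g0_sq κ a hh]
  calc m * b * Real.log (a / (2 * h)) = m * (b * Real.log (a / (2 * h))) := by ring
    _ ≤ m * ∑ p ∈ disc (a / (2 * h)), weight p := by gcongr; exact hW _ ha
    _ = ∑ p ∈ disc (a / (2 * h)), m * weight p := Finset.mul_sum _ _ _
    _ ≤ _ := Finset.sum_le_sum fun p _ => hG p

lemma exists_log_sq_le {h : ℝ} (hh : 0 < h) {y₁ y₂ : Space} (hy₁ : 0 < y₁ 2) (hy₂ : 0 < y₂ 2) :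
    ∃ c > 0, ∀ a, 4 ≤ a / (2 * h) →
      c * Real.log (a / (2 * h)) ^ 2 ≤ ‖g0 κ h a y₁‖ ^ 2 * ‖g0 κ h a y₂‖ ^ 2 := by
  obtain ⟨c₁, hc₁, h₁⟩ := exists_log_le_norm_g0_sq κ hh hy₁
  obtain ⟨c₂, hc₂, h₂⟩ := exists_log_le_norm_g0_sq κ hh hy₂
  refine ⟨c₁ * c₂, by positivity, fun a ha => ?_⟩
  have hlog : 0 ≤ Real.log (a / (2 * h)) := Real.log_nonneg (by linarith)
  calc c₁ * c₂ * Real.log (a / (2 * h)) ^ 2 =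
        (c₁ * Real.log (a / (2 * h))) * (c₂ * Real.log (a / (2 * h))) := by ring
    _ ≤ _ := mul_le_mul (h₁ a ha) (h₂ a ha) (by positivity) (sq_nonneg _)

end Array

/-! ### Second moments of the two inner products as the aperture grows -/

lemma tendsto_aperture_div {h : ℝ} (hh : 0 < h) :
    Tendsto (fun a : ℝ => a / (2 * h)) atTop atTop :=
  tendsto_id.atTop_div_const (by positivity)

/-- The argument grows quadratically in `a / (2 * h)`, so any factor above two would do; `L` and `h`
affect only how large `a` must be. -/
lemma eventually_log_le {h : ℝ} (hh : 0 < h) (L : ℝ) :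
    ∀ᶠ a : ℝ in atTop, Real.log (1 + a ^ 2 / (4 * L ^ 2)) ≤ 3 * Real.log (a / (2 * h)) := by
  set D := (1 / (4 * L ^ 2)) * (2 * h) ^ 2 with hD
  have hD0 : 0 ≤ D := by positivity
  filter_upwards [(tendsto_aperture_div hh).eventually_ge_atTop (1 + D)] with a ha
  set ρ := a / (2 * h) with hρ
  have ha' : a = ρ * (2 * h) := by rw [hρ]; field_simp
  have e : a ^ 2 / (4 * L ^ 2) = D * ρ ^ 2 := by rw [ha', hD]; ring
  have h1 : 1 ≤ ρ := by linarith
  rw [e, ← Real.log_rpow (by linarith)]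
  refine Real.log_le_log (by positivity) ?_
  have h2 : (1 + D) * ρ ^ 2 ≤ ρ * ρ ^ 2 := by gcongr
  have h3 : 1 ≤ ρ ^ 2 := one_le_pow₀ h1
  norm_cast
  nlinarith

namespace IsRandomMedium

variable {Ω : Type*} [MeasurableSpace Ω] {P : Measure Ω}
  {μ : Space → Ω → ℝ} {R : ℝ → ℝ} {κ σ l h : ℝ} {y₁ y₂ : Space}

lemma isGaussianProcess_path (hμ : IsRandomMedium P μ R l) (h : ℝ) (y : Space) :
    IsGaussianProcess (fun (p : ℤ × ℤ) ω => pathIntegral μ l (transducer h p) y ω) P :=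
  hμ.gaussian.comp_right fun p : ℤ × ℤ => (transducer h p, y)

lemma isGaussianProcess_path_sub (hμ : IsRandomMedium P μ R l) (h : ℝ) (y₁ y₂ : Space) :
    IsGaussianProcess (fun (p : ℤ × ℤ) ω => pathIntegral μ l (transducer h p) y₂ ω -
      pathIntegral μ l (transducer h p) y₁ ω) P := by
  classical
  exact hμ.gaussian.of_isGaussianProcess fun p =>
    ⟨{(transducer h p, y₂), (transducer h p, y₁)},
      { toFun x := x ⟨(transducer h p, y₂), by simp⟩ - x ⟨(transducer h p, y₁), by simp⟩
        map_add' x y := by simp; abel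
        map_smul' m x := by simp; ring },
      by simp⟩

variable [IsProbabilityMeasure P]

/-- Only the path to `y₂` carries a random phase, and its variance is linear in the distance with a
positive slope. This gains a full factor `log a` over the trivial bound, from which the rate of `V`
follows. -/
lemma integral_norm_inner_g0_g_sq_le (hμ : IsRandomMedium P μ R l) (hl : 0 < l) (hκ : 0 < κ)
    (hσ : 0 < σ) (hh : 0 < h) (hy₁ : 0 < y₁ 2) (hy₂ : 0 < y₂ 2) {η : ℝ} (hη : 0 < η) :
    ∀ᶠ a : ℝ in atTop, ∫ ω, ‖inner ℂ (g0 κ h a y₁) (g μ κ σ l h a y₂ ω)‖ ^ 2 ∂P ≤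
      η * Real.log (a / (2 * h)) := by
  obtain ⟨B, hB, hBa⟩ := exists_norm_amplitude_le κ hh hy₁ hy₂
  obtain ⟨C, hC⟩ := hμ.exists_abs_norm_path_sq_sub_le hl
  have hr := hμ.Rhat0_pos
  have hlin : ∀ p : ℤ × ℤ, |(σ * κ * ‖hμ.path hl (transducer h p) y₂‖) ^ 2 -
      (σ * κ) ^ 2 * (l * Rhat0 R * h) * latticeNorm p| ≤
      (σ * κ) ^ 2 * (C + l * Rhat0 R * ‖y₂‖) := by
    intro p
    have h1 := abs_le.1 (hC _ _ (transducer_ne (h := h) hy₂ p))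
    have h2 := abs_le.1 (abs_norm_transducer_sub_sub_le hh p y₂)
    have e : (σ * κ * ‖hμ.path hl (transducer h p) y₂‖) ^ 2 -
      (σ * κ) ^ 2 * (l * Rhat0 R * h) * latticeNorm p = (σ * κ) ^ 2 *
        (‖hμ.path hl (transducer h p) y₂‖ ^ 2 - l * Rhat0 R * (h * latticeNorm p)) := by ring
    rw [e, abs_mul, abs_of_nonneg (sq_nonneg (σ * κ))]
    refine mul_le_mul_of_nonneg_left ?_ (sq_nonneg _)
    have hlr : 0 ≤ l * Rhat0 R := by positivity
    have h3 := mul_le_mul_of_nonneg_left h2.1 hlr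
    have h4 := mul_le_mul_of_nonneg_left h2.2 hlr
    rw [abs_le]
    constructor <;> linarith
  have hpair := pairSum_le_of_linear (τ := fun p => σ * κ * ‖hμ.path hl (transducer h p) y₂‖)
    (show 0 < (σ * κ) ^ 2 * (l * Rhat0 R * h) by positivity) (fun p => by positivity) hlin
    (η := η / B ^ 2) (by positivity)
  filter_upwards [(tendsto_aperture_div hh).eventually hpair] with a ha
  simp_rw [inner_g0_g μ κ σ l a hh]
  refine (integral_norm_sum_exp_sq_le_pairSum
    (fun p => hμ.coeFn_path hl (transducer_ne hy₂ p))
    (fun p => hμ.integral_pathIntegral hl (transducer_ne hy₂ p))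
    (hμ.isGaussianProcess_path h y₂) hBa _).trans ?_
  calc _ ≤ B ^ 2 * (η / B ^ 2 * Real.log (a / (2 * h))) := by gcongr
    _ = _ := by field_simp

/-- The phase is a difference of two path integrals that may almost cancel, so only the sparse form
of the interaction bound is available; `y₁ ≠ y₂` makes the exceptional set sparse. -/
lemma integral_norm_inner_g_g_sq_le (hμ : IsRandomMedium P μ R l) (hl : 0 < l) (hκ : 0 < κ)
    (hσ : 0 < σ) (hh : 0 < h) (hy₁ : 0 < y₁ 2) (hy₂ : 0 < y₂ 2) (hne : y₁ ≠ y₂) {η : ℝ}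
    (hη : 0 < η) :
    ∀ᶠ a : ℝ in atTop, ∫ ω, ‖inner ℂ (g μ κ σ l h a y₁ ω) (g μ κ σ l h a y₂ ω)‖ ^ 2 ∂P ≤
      η * Real.log (a / (2 * h)) ^ 2 := by
  obtain ⟨B, hB, hBa⟩ := exists_norm_amplitude_le κ hh hy₁ hy₂
  obtain ⟨C, hC⟩ := hμ.exists_abs_norm_path_sq_sub_le hl
  have hr := hμ.Rhat0_pos
  set ζ : ℤ × ℤ → Lp ℝ 2 P := fun p =>
    hμ.path hl (transducer h p) y₂ - hμ.path hl (transducer h p) y₁ with hζ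
  have hupper : ∀ p : ℤ × ℤ, (σ * κ * ‖ζ p‖) ^ 2 ≤
      (σ * κ) ^ 2 * (4 * (l * Rhat0 R * h)) * latticeNorm p +
      (σ * κ) ^ 2 * (4 * C + 2 * (l * Rhat0 R) * (‖y₁‖ + ‖y₂‖)) := by
    intro p
    have h1 := (abs_le.1 (hC _ _ (transducer_ne (h := h) hy₁ p))).2
    have h2 := (abs_le.1 (hC _ _ (transducer_ne (h := h) hy₂ p))).2
    have d1 := (abs_le.1 (abs_norm_transducer_sub_sub_le hh p y₁)).2
    have d2 := (abs_le.1 (abs_norm_transducer_sub_sub_le hh p y₂)).2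
    have hlr : 0 ≤ l * Rhat0 R := by positivity
    have d3 := mul_le_mul_of_nonneg_left d1 hlr
    have d4 := mul_le_mul_of_nonneg_left d2 hlr
    have h3 : ‖ζ p‖ ^ 2 ≤ 2 * ‖hμ.path hl (transducer h p) y₂‖ ^ 2 +
        2 * ‖hμ.path hl (transducer h p) y₁‖ ^ 2 := by
      have h4 := norm_sub_le (hμ.path hl (transducer h p) y₂) (hμ.path hl (transducer h p) y₁)
      have h5 := pow_le_pow_left₀ (norm_nonneg _) h4 2
      refine h5.trans ?_
      nlinarith [sq_nonneg (‖hμ.path hl (transducer h p) y₂‖ -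
        ‖hμ.path hl (transducer h p) y₁‖)]
    rw [mul_pow, mul_assoc, ← mul_add]
    refine mul_le_mul_of_nonneg_left ?_ (sq_nonneg _)
    linarith
  have hsparse : ∀ δ > 0, ∃ (Z : Set (ℤ × ℤ)) (b K : ℝ), 0 < b ∧
      (∀ p ∉ Z, b * latticeNorm p - K ≤ (σ * κ * ‖ζ p‖) ^ 2) ∧
      ∀ ρ, 2 ≤ ρ → ∀ S ⊆ disc ρ, (∀ p ∈ S, p ∈ Z) →
        ∑ p ∈ S, weight p ≤ δ * Real.log ρ + K := by
    intro δ hδ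
    obtain ⟨ε, hε, K, hK⟩ := exists_sum_weight_le_of_small_angle hh hy₁ hy₂ hne hδ
    obtain ⟨b, hb, D, hD⟩ := hμ.exists_le_norm_path_sub_path_sq hl y₁ y₂ hε
    -- The exceptional set: transducers for which `y₁` is closer than `ε` to the line from the
    -- transducer through `y₂`.
    refine ⟨{p | ‖transducer h p - y₁‖ * √(1 - (inner ℝ (direction (transducer h p) y₁)
        (direction (transducer h p) y₂)) ^ 2) < ε}, (σ * κ) ^ 2 * (b * h),
      max K ((σ * κ) ^ 2 * (b * ‖y₁‖ + D)), by positivity, fun p hp => ?_,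
      fun ρ hρ S hS hSZ => (hK ρ hρ S hS hSZ).trans (by gcongr; exact le_max_left _ _)⟩
    have h1 := hD _ (transducer_ne hy₁ p) (transducer_ne hy₂ p) (not_lt.1 hp)
    have d1 := (abs_le.1 (abs_norm_transducer_sub_sub_le hh p y₁)).1
    have d2 := mul_le_mul_of_nonneg_left d1 hb.le
    have h2 := mul_le_mul_of_nonneg_left h1 (sq_nonneg (σ * κ))
    have h3 := mul_le_mul_of_nonneg_left d2 (sq_nonneg (σ * κ))
    have h4 := le_max_right K ((σ * κ) ^ 2 * (b * ‖y₁‖ + D))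
    have h5 : (σ * κ * ‖ζ p‖) ^ 2 =
        (σ * κ) ^ 2 * ‖hμ.path hl (transducer h p) y₂ - hμ.path hl (transducer h p) y₁‖ ^ 2 :=
      mul_pow _ _ _
    rw [h5]
    linarith
  have hpair := pairSum_le_of_sparse (τ := fun p => σ * κ * ‖ζ p‖)
    (show 0 < (σ * κ) ^ 2 * (4 * (l * Rhat0 R * h)) by positivity) (fun p => by positivity)
    hupper hsparse (η := η / B ^ 2) (by positivity)
  filter_upwards [(tendsto_aperture_div hh).eventually hpair] with a ha
  simp_rw [inner_g_g μ κ σ l a hh]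
  refine (integral_norm_sum_exp_sq_le_pairSum (ζ := ζ) (fun p => ?_) (fun p => ?_)
    (hμ.isGaussianProcess_path_sub h y₁ y₂) hBa _).trans ?_
  · filter_upwards [hμ.coeFn_path hl (transducer_ne hy₁ p), hμ.coeFn_path hl (transducer_ne hy₂ p),
      Lp.coeFn_sub (hμ.path hl (transducer h p) y₂) (hμ.path hl (transducer h p) y₁)]
      with ω h1 h2 h3
    rw [hζ, h3, Pi.sub_apply, h1, h2]
  · rw [integral_sub ((hμ.isGaussianProcess_path h y₂).hasGaussianLaw_eval p).integrable
      ((hμ.isGaussianProcess_path h y₁).hasGaussianLaw_eval p).integrable,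
      hμ.integral_pathIntegral hl (transducer_ne hy₂ p),
      hμ.integral_pathIntegral hl (transducer_ne hy₁ p), sub_zero]
  · calc _ ≤ B ^ 2 * (η / B ^ 2 * Real.log (a / (2 * h)) ^ 2) := by gcongr
      _ = _ := by field_simp

end IsRandomMedium

/-- Asymptotic orthogonality from a bound for the second moments of the inner products. -/
lemma tendstoInMeasure_div_of_integral_sq_le {Ω : Type*} [MeasurableSpace Ω] {P : Measure Ω}
    {κ h : ℝ} (hh : 0 < h) {y₁ y₂ : Space} (hy₁ : 0 < y₁ 2) (hy₂ : 0 < y₂ 2)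
    {F : ℝ → Ω → ℂ} (hF : ∀ a, MemLp (F a) 2 P)
    (hFη : ∀ η > 0, ∀ᶠ a : ℝ in atTop,
      ∫ ω, ‖F a ω‖ ^ 2 ∂P ≤ η * Real.log (a / (2 * h)) ^ 2) :
    TendstoInMeasure P
      (fun a ω => F a ω / ((‖g0 κ h a y₁‖ * ‖g0 κ h a y₂‖ : ℝ) : ℂ)) atTop fun _ => 0 := by
  obtain ⟨c, hc, hN⟩ := exists_log_sq_le κ hh hy₁ hy₂
  refine tendstoInMeasure_of_tendsto_integral_sq (fun a => ?_) ?_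
  · simp_rw [div_eq_mul_inv]
    exact (hF a).mul_const _
  rw [Metric.tendsto_atTop']
  intro η hη
  obtain ⟨a₀, ha₀⟩ := eventually_atTop.1 ((hFη (η * c / 2) (by positivity)).and
    ((tendsto_aperture_div hh).eventually_ge_atTop 4))
  refine ⟨a₀, fun a ha => ?_⟩
  obtain ⟨h1, h2⟩ := ha₀ a ha.le
  have hlog : 0 < Real.log (a / (2 * h)) := Real.log_pos (by linarith)
  have h3 := hN a h2
  have e : ∀ ω, ‖F a ω / ((‖g0 κ h a y₁‖ * ‖g0 κ h a y₂‖ : ℝ) : ℂ)‖ ^ 2 =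
      ‖F a ω‖ ^ 2 / (‖g0 κ h a y₁‖ ^ 2 * ‖g0 κ h a y₂‖ ^ 2) := by
    intro ω
    rw [norm_div, Complex.norm_real, div_pow, Real.norm_eq_abs, sq_abs, mul_pow]
  simp_rw [e]
  rw [integral_div, Real.dist_eq, sub_zero,
    abs_of_nonneg (div_nonneg (integral_nonneg fun ω => sq_nonneg _) (by positivity))]
  have h4 : 0 < c * Real.log (a / (2 * h)) ^ 2 := by positivity
  rw [div_lt_iff₀ (h4.trans_le h3)]
  have h5 := mul_le_mul_of_nonneg_left h3 hη.le
  have h6 : 0 < η * (c * Real.log (a / (2 * h)) ^ 2) := by positivity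
  linarith

end RandomPhase

end

/-! ### Conclusion -/

open RandomPhase

theorem proposition3 {Ω : Type*} [MeasurableSpace Ω] (P : Measure Ω) [IsProbabilityMeasure P]
    (μ : RandomPhase.Space → Ω → ℝ) (R : ℝ → ℝ) (κ σ l L h : ℝ)
    (hκ : 0 < κ) (hσ : 0 < σ) (hl : 0 < l) (hL : 0 < L) (hh : 0 < h)
    (hμ : RandomPhase.IsRandomMedium P μ R l)
    (y₁ y₂ : RandomPhase.Space) (hy₁ : 0 < y₁ 2) (hy₂ : 0 < y₂ 2) (hne : y₁ ≠ y₂) :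
    TendstoInMeasure P
      (fun (a : ℝ) (ω : Ω) =>
        inner ℂ (RandomPhase.g μ κ σ l h a y₁ ω) (RandomPhase.g μ κ σ l h a y₂ ω) /
          ((‖RandomPhase.g μ κ σ l h a y₁ ω‖ * ‖RandomPhase.g μ κ σ l h a y₂ ω‖ : ℝ) : ℂ))
      atTop (fun _ => (0 : ℂ)) ∧
    TendstoInMeasure P
      (fun (a : ℝ) (ω : Ω) =>
        inner ℂ (RandomPhase.g0 κ h a y₁) (RandomPhase.g μ κ σ l h a y₂ ω) /
          ((‖RandomPhase.g0 κ h a y₁‖ * ‖RandomPhase.g μ κ σ l h a y₂ ω‖ : ℝ) : ℂ))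
      atTop (fun _ => (0 : ℂ)) ∧
    Tendsto (RandomPhase.mixedRatio P μ κ σ l h y₁ y₂) atTop (𝓝 0) ∧
    ∀ᶠ a : ℝ in atTop,
      RandomPhase.mixedRatio P μ κ σ l h y₁ y₂ a ≤
        (1 - Real.exp (-(κ ^ 2 * σ ^ 2 * L * l * RandomPhase.Rhat0 R))) *
          (Real.log (1 + l ^ 2 / (4 * L ^ 2)) / Real.log (1 + a ^ 2 / (4 * L ^ 2))) := by
  have hmem1 : ∀ a, MemLp (fun ω => inner ℂ (g0 κ h a y₁) (g μ κ σ l h a y₂ ω)) 2 P := by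
    intro a
    simp_rw [inner_g0_g μ κ σ l a hh]
    exact memLp_sum_exp _ _ fun p => ((hμ.isGaussianProcess_path h y₂).aemeasurable p).const_mul _
  have hmem2 : ∀ a, MemLp (fun ω => inner ℂ (g μ κ σ l h a y₁ ω) (g μ κ σ l h a y₂ ω)) 2 P := by
    intro a
    simp_rw [inner_g_g μ κ σ l a hh]
    exact memLp_sum_exp _ _ fun p =>
      ((hμ.isGaussianProcess_path_sub h y₁ y₂).aemeasurable p).const_mul _
  obtain ⟨c, hc, hN⟩ := exists_log_sq_le κ hh hy₁ hy₂
  -- The numerator is `o(log a)` and the denominator at least a multiple of `(log a)²`, so the ratio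
  -- is `o(1 / log a)`; both its limit and its rate come from this.
  have hratio : ∀ η > 0, ∀ᶠ a : ℝ in atTop,
      mixedRatio P μ κ σ l h y₁ y₂ a ≤ η / Real.log (a / (2 * h)) := by
    intro η hη
    filter_upwards [hμ.integral_norm_inner_g0_g_sq_le hl hκ hσ hh hy₁ hy₂
      (η := η * c) (by positivity), (tendsto_aperture_div hh).eventually_ge_atTop 4] with a h1 h2
    have hlog : 0 < Real.log (a / (2 * h)) := Real.log_pos (by linarith)
    have h3 := hN a h2
    have h4 := (complexVariance_le (hmem1 a)).trans h1
    rw [mixedRatio]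
    simp only [norm_g, integral_const, probReal_univ, one_smul]
    have h5 : 0 < c * Real.log (a / (2 * h)) ^ 2 := by positivity
    rw [div_le_div_iff₀ (h5.trans_le h3) hlog]
    have h6 := mul_le_mul_of_nonneg_left h3 hη.le
    have h7 := mul_le_mul_of_nonneg_right h4 hlog.le
    linarith
  have hratio0 : ∀ a, 0 ≤ mixedRatio P μ κ σ l h y₁ y₂ a := fun a =>
    div_nonneg (integral_nonneg fun ω => sq_nonneg _)
      (mul_nonneg (sq_nonneg _) (integral_nonneg fun ω => sq_nonneg _))
  have hlogtop : Tendsto (fun a : ℝ => Real.log (a / (2 * h))) atTop atTop :=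
    Real.tendsto_log_atTop.comp (tendsto_aperture_div hh)
  refine ⟨?_, ?_, ?_, ?_⟩
  · simp_rw [norm_g]
    exact tendstoInMeasure_div_of_integral_sq_le hh hy₁ hy₂ hmem2 fun η hη =>
      hμ.integral_norm_inner_g_g_sq_le hl hκ hσ hh hy₁ hy₂ hne hη
  · simp_rw [norm_g]
    refine tendstoInMeasure_div_of_integral_sq_le hh hy₁ hy₂ hmem1 fun η hη => ?_
    filter_upwards [hμ.integral_norm_inner_g0_g_sq_le hl hκ hσ hh hy₁ hy₂ hη,
      hlogtop.eventually_ge_atTop 1] with a h1 h2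
    refine h1.trans (mul_le_mul_of_nonneg_left ?_ hη.le)
    nlinarith
  · refine squeeze_zero' (.of_forall hratio0) (hratio 1 one_pos) ?_
    exact hlogtop.const_div_atTop 1
  · set K := (1 - Real.exp (-(κ ^ 2 * σ ^ 2 * L * l * Rhat0 R))) *
      Real.log (1 + l ^ 2 / (4 * L ^ 2)) with hK
    have hr := hμ.Rhat0_pos
    have hK0 : 0 < K := by
      refine mul_pos (sub_pos.2 (Real.exp_lt_one_iff.2 ?_)) (Real.log_pos ?_)
      · rw [neg_lt_zero]; positivity
      · have : 0 < l ^ 2 / (4 * L ^ 2) := by positivity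
        linarith
    -- Any positive `K` would serve; the `3` cancels the factor in `eventually_log_le`.
    filter_upwards [hratio (K / 3) (by positivity), eventually_log_le hh L,
      hlogtop.eventually_ge_atTop 1, eventually_gt_atTop 0] with a h1 h2 h3 h4
    refine h1.trans ?_
    rw [← mul_div_assoc, ← hK, div_div]
    have h5 : 0 < Real.log (1 + a ^ 2 / (4 * L ^ 2)) := by
      apply Real.log_pos
      have : 0 < a ^ 2 / (4 * L ^ 2) := by positivity
      linarith
    exact div_le_div_of_nonneg_left hK0.le h5 h2
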